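/- Let $D=\{z\in\mathbb C:|z|<1\}$ and let $dA$ be Lebesgue area measure on $D$, normalized so that $D$ has measure $1$. Let $L^2_a$ be the Bergman space, that is, the closed subspace of $L^2(D,dA)$ consisting of the functions that are analytic on $D$, and let $P$ be the orthogonal projection of $L^2(D,dA)$ onto $L^2_a$. For $z\in D$ let $K_z\in L^2_a$ be the reproducing kernel, determined by $f(z)=\langle f,K_z\rangle$ for every $f\in L^2_a$, and let $k_z=K_z/\|K_z\|_2$. For $u\in L^\infty(D,dA)$ let $T_u\colon L^2_a\to L^2_a$, $T_uf=P(uf)$, be the Toeplitz operator with symbol $u$, and let \[ \tilde u(z)=\langle T_uk_z,k_z\rangle=\int_D u\,|k_z|^2\,dA\qquad(z\in D) \] be the Berezin transform of $u$. If $u\in L^\infty(D,dA)$, then $T_u$ is compact if and only if $\tilde u(z)\to 0$ as $z\to\partial D$ (that is, as $|z|\to 1$). -/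

import Mathlib

open MeasureTheory Metric Set Filter Topology Complex.UnitDisc
open scoped ENNReal

noncomputable section

/-- Lebesgue area measure on the open unit disk, normalized to have total mass `1`. -/
def diskMeasure : Measure ℂ :=
  (volume (ball (0 : ℂ) 1))⁻¹ • volume.restrict (ball (0 : ℂ) 1)

instance : IsProbabilityMeasure diskMeasure := by
  refine ⟨?_⟩
  simp only [diskMeasure, Measure.smul_apply, Measure.restrict_apply_univ, smul_eq_mul]
  exact ENNReal.inv_mul_cancel (measure_ball_pos volume _ one_pos).ne' measure_ball_lt_top.ne

/-- The Bergman space: the (classes of) functions in `L²(D, dA)` that are analytic on `D`. -/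
def bergmanSpace : Submodule ℂ (Lp ℂ 2 diskMeasure) where
  carrier := {f | ∃ g : ℂ → ℂ, DifferentiableOn ℂ g (ball 0 1) ∧ f =ᵐ[diskMeasure] g}
  add_mem' := by
    rintro a b ⟨g, hg, hag⟩ ⟨h, hh, hbh⟩
    exact ⟨g + h, hg.add hh, (Lp.coeFn_add a b).trans (hag.add hbh)⟩
  zero_mem' := ⟨0, differentiableOn_const 0, Lp.coeFn_zero _ _ _⟩
  smul_mem' := by
    rintro c a ⟨g, hg, hag⟩
    exact ⟨c • g, hg.const_smul c, (Lp.coeFn_smul c a).trans (hag.const_smul c)⟩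

lemma enorm_le_circle {g : ℂ → ℂ} (hg : DifferentiableOn ℂ g (ball 0 1)) {z w : ℂ}
    (hw : ‖w‖ < 1 - ‖z‖) :
    ENNReal.ofReal (2 * Real.pi) * ‖g z‖ₑ ≤
      ∫⁻ θ in Ioc 0 (2 * Real.pi), ‖g (z + circleMap 0 1 θ * w)‖ₑ := by
  have hd : DifferentiableOn ℂ (fun ζ => g (z + ζ * w)) (closedBall 0 1) := by
    refine hg.comp (by fun_prop) ?_
    intro ζ hζ
    rw [mem_closedBall_zero_iff] at hζ
    rw [mem_ball_zero_iff]
    calc ‖z + ζ * w‖ ≤ ‖z‖ + ‖ζ‖ * ‖w‖ := (norm_add_le _ _).trans (by rw [norm_mul])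
      _ < 1 := by nlinarith [norm_nonneg w]
  have h := DiffContOnCl.circleAverage (R := 1) (c := 0) (f := fun ζ => g (z + ζ * w))
    (by rw [abs_one]; exact hd.diffContOnCl_ball subset_rfl)
  rw [Real.circleAverage_def] at h
  have h2 : ((2 * Real.pi : ℝ) : ℂ) * g z
      = ∫ θ in 0..2 * Real.pi, g (z + circleMap 0 1 θ * w) := by
    rw [show g z = g (z + 0 * w) by simp, ← h, Complex.real_smul, ← mul_assoc]
    have : ((2 * Real.pi : ℝ) : ℂ) ≠ 0 := by exact_mod_cast Real.two_pi_pos.ne'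
    rw [Complex.ofReal_inv, mul_inv_cancel₀ this, one_mul]
  rw [intervalIntegral.integral_of_le Real.two_pi_pos.le] at h2
  calc _ = ‖((2 * Real.pi : ℝ) : ℂ) * g z‖ₑ := by
        rw [enorm_mul]; congr 1
        rw [← ofReal_norm, Complex.norm_real, Real.norm_of_nonneg Real.two_pi_pos.le]
    _ ≤ _ := by rw [h2]; exact enorm_integral_le_lintegral_enorm _

lemma enorm_le_area {g : ℂ → ℂ} (hg : DifferentiableOn ℂ g (ball 0 1)) (z : ℂ) :
    volume (ball (0 : ℂ) (1 - ‖z‖)) * ‖g z‖ₑ ≤ ∫⁻ w in ball 0 1, ‖g w‖ₑ := by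
  set s := 1 - ‖z‖
  set G : ℂ → ℝ≥0∞ := (ball 0 1).indicator fun w => ‖g w‖ₑ with hG
  have hGm : Measurable G := by
    have : Measurable ((ball (0 : ℂ) 1).indicator g) := by
      classical
      rw [← piecewise_eq_indicator]
      exact hg.continuousOn.measurable_piecewise continuousOn_const isOpen_ball.measurableSet
    convert this.enorm using 2 with w
    simp [hG, indicator]; split_ifs <;> simp
  have hpt : ∀ w ∈ ball (0 : ℂ) s, ENNReal.ofReal (2 * Real.pi) * ‖g z‖ₑ ≤
      ∫⁻ θ in Ioc 0 (2 * Real.pi), G (z + circleMap 0 1 θ * w) := by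
    intro w hw
    rw [mem_ball_zero_iff] at hw
    refine (enorm_le_circle hg hw).trans_eq (lintegral_congr fun θ => ?_)
    rw [hG, indicator_of_mem]
    rw [mem_ball_zero_iff]
    calc _ ≤ ‖z‖ + ‖circleMap 0 1 θ‖ * ‖w‖ := (norm_add_le _ _).trans (by rw [norm_mul])
      _ < 1 := by simp; linarith
  have hint : ∀ θ : ℝ, ∫⁻ w in ball (0 : ℂ) s, G (z + circleMap 0 1 θ * w)
      ≤ ∫⁻ w in ball 0 1, ‖g w‖ₑ := by
    intro θ
    refine (setLIntegral_le_lintegral _ _).trans_eq ?_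
    have hmp := (rotation (Circle.exp θ)).measurePreserving
    have h1 := hmp.lintegral_comp (f := fun w => G (z + w)) (by fun_prop)
    have : ∀ w, circleMap 0 1 θ * w = rotation (Circle.exp θ) w := by
      intro w; simp [circleMap]
    simp_rw [this]
    rw [h1, lintegral_add_left_eq_self, hG, lintegral_indicator isOpen_ball.measurableSet]
  have h2π : ENNReal.ofReal (2 * Real.pi) ≠ 0 := by simp [Real.pi_pos]
  refine (ENNReal.mul_le_mul_iff_right h2π ENNReal.ofReal_ne_top).1 ?_
  calc _ = ∫⁻ w in ball (0 : ℂ) s, ENNReal.ofReal (2 * Real.pi) * ‖g z‖ₑ := by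
        rw [setLIntegral_const]; ring
    _ ≤ ∫⁻ w in ball (0 : ℂ) s, ∫⁻ θ in Ioc 0 (2 * Real.pi), G (z + circleMap 0 1 θ * w) :=
        setLIntegral_mono' isOpen_ball.measurableSet hpt
    _ = ∫⁻ θ in Ioc 0 (2 * Real.pi), ∫⁻ w in ball (0 : ℂ) s, G (z + circleMap 0 1 θ * w) := by
        refine lintegral_lintegral_swap (Measurable.aemeasurable ?_)
        refine hGm.comp (Continuous.measurable ?_)
        have := continuous_circleMap 0 1
        fun_prop
    _ ≤ ∫⁻ θ in Ioc 0 (2 * Real.pi), ∫⁻ w in ball 0 1, ‖g w‖ₑ := lintegral_mono hint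
    _ = _ := by rw [setLIntegral_const, Real.volume_Ioc, sub_zero, mul_comm]

/-- Point evaluations are bounded on the Bergman space, locally uniformly in the point. -/
lemma norm_le_of_ae_eq {g : ℂ → ℂ} (hg : DifferentiableOn ℂ g (ball 0 1)) {z : ℂ}
    (hz : z ∈ ball (0 : ℂ) 1) {f : Lp ℂ 2 diskMeasure} (hf : f =ᵐ[diskMeasure] g) :
    ‖g z‖ ≤ ((1 - ‖z‖) ^ 2)⁻¹ * ‖f‖ := by
  rw [mem_ball_zero_iff] at hz
  have hs : 0 < 1 - ‖z‖ := by linarith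
  have hV0 : volume (ball (0 : ℂ) 1) ≠ 0 := (measure_ball_pos volume _ one_pos).ne'
  have hVt : volume (ball (0 : ℂ) 1) ≠ ∞ := measure_ball_lt_top.ne
  have h1 := enorm_le_area hg z
  have h2 : ∫⁻ w in ball 0 1, ‖g w‖ₑ ≤ volume (ball (0 : ℂ) 1) * ‖f‖ₑ := by
    have e1 : eLpNorm g 1 diskMeasure = (volume (ball (0 : ℂ) 1))⁻¹ * ∫⁻ w in ball 0 1, ‖g w‖ₑ := by
      rw [eLpNorm_one_eq_lintegral_enorm, diskMeasure, lintegral_smul_measure, smul_eq_mul]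
    have e2 : eLpNorm g 1 diskMeasure ≤ ‖f‖ₑ := by
      rw [Lp.enorm_def, ← eLpNorm_congr_ae hf]
      exact eLpNorm_le_eLpNorm_of_exponent_le one_le_two (Lp.aestronglyMeasurable f)
    rw [e1] at e2
    calc _ = volume (ball (0 : ℂ) 1) * ((volume (ball (0 : ℂ) 1))⁻¹ *
            ∫⁻ w in ball 0 1, ‖g w‖ₑ) := by
          rw [← mul_assoc, ENNReal.mul_inv_cancel hV0 hVt, one_mul]
      _ ≤ _ := by gcongr
  rw [Measure.addHaar_ball _ _ hs.le, Complex.finrank_real_complex] at h1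
  have h3 : ENNReal.ofReal ((1 - ‖z‖) ^ 2) * ‖g z‖ₑ ≤ ‖f‖ₑ := by
    refine (ENNReal.mul_le_mul_iff_right hV0 hVt).1 ((le_of_eq (by ring)).trans (h1.trans h2))
  rw [← ofReal_norm, ← ofReal_norm, ← ENNReal.ofReal_mul (by positivity),
    ENNReal.ofReal_le_ofReal_iff (norm_nonneg _)] at h3
  rwa [inv_mul_eq_div, le_div_iff₀' (by positivity)]

namespace bergmanSpace

/-- The analytic function on `D` representing an element of the Bergman space
(its values outside `D` are irrelevant). -/
def rep (f : bergmanSpace) : ℂ → ℂ := f.2.choose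

lemma differentiableOn_rep (f : bergmanSpace) : DifferentiableOn ℂ (rep f) (ball 0 1) :=
  f.2.choose_spec.1

lemma coe_ae_eq_rep (f : bergmanSpace) : (f : Lp ℂ 2 diskMeasure) =ᵐ[diskMeasure] rep f :=
  f.2.choose_spec.2

lemma rep_eqOn {f : bergmanSpace} {g : ℂ → ℂ} (hg : DifferentiableOn ℂ g (ball 0 1))
    (h : (f : Lp ℂ 2 diskMeasure) =ᵐ[diskMeasure] g) : EqOn (rep f) g (ball 0 1) := by
  intro z hz
  have h0 : ((0 : Lp ℂ 2 diskMeasure) : ℂ → ℂ) =ᵐ[diskMeasure] rep f - g := by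
    filter_upwards [coe_ae_eq_rep f, h, Lp.coeFn_zero ℂ 2 diskMeasure] with w h1 h2 h3
    simp [← h1, ← h2]
  have := norm_le_of_ae_eq ((differentiableOn_rep f).sub hg) hz h0
  rw [norm_zero, mul_zero] at this
  exact sub_eq_zero.1 (norm_le_zero_iff.1 this)

lemma rep_add (f g : bergmanSpace) : EqOn (rep (f + g)) (rep f + rep g) (ball 0 1) :=
  rep_eqOn ((differentiableOn_rep f).add (differentiableOn_rep g))
    ((Lp.coeFn_add _ _).trans ((coe_ae_eq_rep f).add (coe_ae_eq_rep g)))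

lemma rep_smul (c : ℂ) (f : bergmanSpace) : EqOn (rep (c • f)) (c • rep f) (ball 0 1) :=
  rep_eqOn ((differentiableOn_rep f).const_smul c)
    ((Lp.coeFn_smul _ _).trans ((coe_ae_eq_rep f).const_smul c))

lemma rep_sub (f g : bergmanSpace) : EqOn (rep (f - g)) (rep f - rep g) (ball 0 1) :=
  rep_eqOn ((differentiableOn_rep f).sub (differentiableOn_rep g))
    ((Lp.coeFn_sub _ _).trans ((coe_ae_eq_rep f).sub (coe_ae_eq_rep g)))

lemma norm_rep_le (f : bergmanSpace) {z : ℂ} (hz : z ∈ ball (0 : ℂ) 1) :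
    ‖rep f z‖ ≤ ((1 - ‖z‖) ^ 2)⁻¹ * ‖f‖ :=
  norm_le_of_ae_eq (differentiableOn_rep f) hz (coe_ae_eq_rep f)

/-- Evaluation at the points of `D`, which makes the Bergman space a reproducing kernel
Hilbert space of functions on `D`. -/
instance : RKHS ℂ bergmanSpace 𝔻 ℂ where
  coeCLM := ContinuousLinearMap.pi fun z =>
    LinearMap.mkContinuous
      { toFun := fun f => rep f z
        map_add' := fun f g => rep_add f g (mem_ball_zero_iff.2 z.norm_lt_one)
        map_smul' := fun c f => rep_smul c f (mem_ball_zero_iff.2 z.norm_lt_one) }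
      ((1 - ‖(z : ℂ)‖) ^ 2)⁻¹ fun f => norm_rep_le f (mem_ball_zero_iff.2 z.norm_lt_one)
  coeCLM_injective := by
    intro f g h
    have h' : ∀ w ∈ ball (0 : ℂ) 1, rep f w = rep g w := fun w hw =>
      congrFun h (Complex.UnitDisc.mk w (mem_ball_zero_iff.1 hw))
    refine Subtype.ext (Lp.ext ?_)
    have hae : ∀ᵐ w ∂diskMeasure, w ∈ ball (0 : ℂ) 1 :=
      Measure.ae_smul_measure (ae_restrict_mem isOpen_ball.measurableSet) _
    filter_upwards [coe_ae_eq_rep f, coe_ae_eq_rep g, hae] with w h1 h2 h3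
    rw [h1, h2, h' w h3]

/-- The value at `z` of an element of the Bergman space is the value of the analytic function
that represents it. -/
lemma apply_eq {f : bergmanSpace} {g : ℂ → ℂ} (hg : DifferentiableOn ℂ g (ball 0 1))
    (h : (f : Lp ℂ 2 diskMeasure) =ᵐ[diskMeasure] g) (z : 𝔻) : f z = g z :=
  rep_eqOn hg h (mem_ball_zero_iff.2 z.norm_lt_one)

lemma isClosed : IsClosed (bergmanSpace : Set (Lp ℂ 2 diskMeasure)) := by
  refine isSeqClosed_iff_isClosed.1 ?_
  intro F f hF hlim
  let B : ℕ → bergmanSpace := fun n => ⟨F n, hF n⟩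
  have hC : CauchySeq B := by
    have := hlim.cauchySeq
    rwa [Metric.cauchySeq_iff] at this ⊢
  -- pointwise limit of the representatives
  have hdist : ∀ (m n : ℕ) (z : ℂ), z ∈ ball (0 : ℂ) 1 →
      dist (rep (B m) z) (rep (B n) z) ≤ ((1 - ‖z‖) ^ 2)⁻¹ * dist (B m) (B n) := by
    intro m n z hz
    rw [dist_eq_norm, dist_eq_norm]
    have := norm_rep_le (B m - B n) hz
    rwa [rep_sub _ _ hz] at this
  have hUC : ∀ K ⊆ ball (0 : ℂ) 1, IsCompact K →
      UniformCauchySeqOn (fun n => rep (B n)) atTop K := by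
    intro K hK hKc
    obtain ⟨C, hCb⟩ : ∃ C, ∀ z ∈ K, ((1 - ‖z‖) ^ 2)⁻¹ ≤ C := by
      have hcont : ContinuousOn (fun z : ℂ => ((1 - ‖z‖) ^ 2)⁻¹) K := by
        refine ContinuousOn.inv₀ (by fun_prop) fun z hz => ?_
        have := mem_ball_zero_iff.1 (hK hz)
        exact pow_ne_zero _ (by linarith)
      obtain ⟨C, hC⟩ := (hKc.bddAbove_image hcont)
      exact ⟨C, fun z hz => hC ⟨z, hz, rfl⟩⟩
    rw [Metric.uniformCauchySeqOn_iff]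
    intro ε hε
    have hpos : 0 < |C| + 1 := by positivity
    obtain ⟨N, hN⟩ := Metric.cauchySeq_iff.1 hC (ε / (|C| + 1)) (by positivity)
    refine ⟨N, fun m hm n hn z hz => (hdist m n z (hK hz)).trans_lt ?_⟩
    have h1 := hN m hm n hn
    rw [lt_div_iff₀ hpos] at h1
    have h2 : ((1 - ‖z‖) ^ 2)⁻¹ ≤ |C| + 1 := by
      linarith [hCb z hz, le_abs_self C]
    nlinarith [dist_nonneg (x := B m) (y := B n)]
  have hpt : ∀ z : ℂ, ∃ l, z ∈ ball (0 : ℂ) 1 → Tendsto (fun n => rep (B n) z) atTop (𝓝 l) := by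
    intro z
    by_cases hz : z ∈ ball (0 : ℂ) 1
    · obtain ⟨l, hl⟩ := cauchySeq_tendsto_of_complete
        ((hUC {z} (singleton_subset_iff.2 hz) isCompact_singleton).cauchySeq rfl)
      exact ⟨l, fun _ => hl⟩
    · exact ⟨0, fun h => absurd h hz⟩
  choose G hG using hpt
  have hGd : DifferentiableOn ℂ G (ball 0 1) := by
    refine TendstoLocallyUniformlyOn.differentiableOn (F := fun n => rep (B n)) (φ := atTop) ?_
      (Eventually.of_forall fun n => differentiableOn_rep (B n)) isOpen_ball
    rw [tendstoLocallyUniformlyOn_iff_forall_isCompact isOpen_ball]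
    intro K hK hKc
    exact (hUC K hK hKc).tendstoUniformlyOn_of_tendsto fun z hz => hG z (hK hz)
  refine ⟨G, hGd, ?_⟩
  obtain ⟨ns, hns, hae⟩ := (tendstoInMeasure_of_tendsto_Lp hlim).exists_seq_tendsto_ae
  have hD : ∀ᵐ w ∂diskMeasure, w ∈ ball (0 : ℂ) 1 :=
    Measure.ae_smul_measure (ae_restrict_mem isOpen_ball.measurableSet) _
  have hall : ∀ᵐ w ∂diskMeasure, ∀ n, F n w = rep (B n) w :=
    ae_all_iff.2 fun n => coe_ae_eq_rep (B n)
  filter_upwards [hae, hD, hall] with w h1 h2 h3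
  refine tendsto_nhds_unique h1 ?_
  simp_rw [h3]
  exact (hG w h2).comp hns.tendsto_atTop

instance : CompleteSpace bergmanSpace := isClosed.completeSpace_coe

end bergmanSpace

/-- The Bergman reproducing kernel `K_z`. -/
def bergmanKernel (z : 𝔻) : bergmanSpace := RKHS.kerFun bergmanSpace z 1

/-- The defining property `f(z) = ⟨f, K_z⟩` of the kernel (in Mathlib the inner product is
conjugate-linear in its first argument). -/
lemma inner_bergmanKernel (z : 𝔻) (f : bergmanSpace) : inner ℂ (bergmanKernel z) f = f z := by
  simp [bergmanKernel, RKHS.kerFun_inner]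

/-- The normalized Bergman reproducing kernel `k_z = K_z / ‖K_z‖₂`. -/
def normalizedKernel (z : 𝔻) : bergmanSpace :=
  ((‖bergmanKernel z‖ : ℂ))⁻¹ • bergmanKernel z

/-- Multiplication by `u ∈ L^∞(D, dA)` as a bounded operator on `L²(D, dA)`. -/
def mulOp (u : Lp ℂ ∞ diskMeasure) : Lp ℂ 2 diskMeasure →L[ℂ] Lp ℂ 2 diskMeasure :=
  (ContinuousLinearMap.mul ℂ ℂ).holderL diskMeasure ∞ 2 2 u

/-- The Toeplitz operator `T_u f = P(u f)` on the Bergman space, where `P` is the orthogonal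
projection of `L²(D, dA)` onto the Bergman space. -/
def toeplitz (u : Lp ℂ ∞ diskMeasure) : bergmanSpace →L[ℂ] bergmanSpace :=
  bergmanSpace.orthogonalProjectionOnto ∘L mulOp u ∘L bergmanSpace.subtypeL

/-- The Berezin transform `S̃(z) = ⟨S k_z, k_z⟩` of a bounded operator on the Bergman space. -/
def berezin (S : bergmanSpace →L[ℂ] bergmanSpace) (z : 𝔻) : ℂ :=
  inner ℂ (normalizedKernel z) (S (normalizedKernel z))

/-- The Berezin transform of a bounded function `u`, that is, of its Toeplitz operator. -/
def berezinSymbol (u : Lp ℂ ∞ diskMeasure) (z : 𝔻) : ℂ :=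
  berezin (toeplitz u) z

/-- The Berezin transform of `u` as an integral: `ũ(z) = ∫ u |k_z|² dA`. -/
lemma berezinSymbol_eq_integral (u : Lp ℂ ∞ diskMeasure) (z : 𝔻) :
    berezinSymbol u z =
      ∫ w, u w * (‖(normalizedKernel z : Lp ℂ 2 diskMeasure) w‖ ^ 2 : ℝ) ∂diskMeasure := by
  simp only [berezinSymbol, berezin, toeplitz, ContinuousLinearMap.comp_apply]
  rw [Submodule.inner_orthogonalProjectionOnto_eq_of_mem_left, L2.inner_def]
  refine integral_congr_ae ?_
  filter_upwards [(ContinuousLinearMap.mul ℂ ℂ).coeFn_holder (r := 2) u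
    (normalizedKernel z : Lp ℂ 2 diskMeasure)] with w hw
  rw [show mulOp u (bergmanSpace.subtypeL (normalizedKernel z)) =
    (ContinuousLinearMap.mul ℂ ℂ).holder 2 u (normalizedKernel z : Lp ℂ 2 diskMeasure) from rfl, hw]
  simp only [RCLike.inner_apply, ContinuousLinearMap.mul_apply']
  rw [mul_assoc, Complex.mul_conj, Complex.normSq_eq_norm_sq]

/-- The filter on `D` of the approach to the boundary, `|z| → 1`. -/
def toBoundary : Filter 𝔻 := comap (fun z : 𝔻 => ‖(z : ℂ)‖) (𝓝 1)
end

/-!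
Necessity: the normalized kernels `k_z` are unit vectors tending weakly to `0` at the boundary, and
a compact operator `S` turns this into `⟨S k_z, k_z⟩ → 0`.

Sufficiency: let `φ_z` be the disk involution exchanging `0` and `z`. The Berezin transform of
`u ∘ φ_z` at `a` is `ũ (φ_z a)`, and `φ_z a → ∂D` as `z → ∂D`, so `⟨T_{u ∘ φ_z} K_a, K_a⟩ → 0` for
every `a`. As a function of `(x, y) = (ā, b)`, the pairing `⟨T_{u ∘ φ_z} K_a, K_b⟩` is holomorphic
and it is known on `y = x̄`; since the elements on which a bounded family of functionals tends to
`0` form a closed subspace, the identity theorem modulo that subspace gives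
`⟨T_{u ∘ φ_z} K_a, K_b⟩ → 0` for all `a` and `b`. In particular `T_{u ∘ φ_z} 1 → 0` pointwise, and
the Forelli–Rudin estimates dominate this convergence, so that it holds in `L⁶`.

A change of variables by `φ_z` and Hölder's inequality bound the integral of
`|⟨T_u K_z, K_w⟩| (1 - |w|²)^(-1/2)` over `w` by a multiple of `‖T_{u ∘ φ_z} 1‖₆ (1 - |z|²)^(-1/2)`.
By the Schur test, the part of `T_u` that comes from `|z| > r` is therefore small in norm for `r`
close to `1`, while the part from `|z| ≤ r` is compact.
-/

open scoped ComplexConjugate NNReal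

noncomputable section

/-! ### Bounded families of operators and compactness -/

section FunctionalAnalysis

variable {𝕜 E F ι : Type*}

section VanishingSubmodule

variable [NontriviallyNormedField 𝕜] [NormedAddCommGroup E] [NormedSpace 𝕜 E]
  [NormedAddCommGroup F] [NormedSpace 𝕜 F]

/-- The subspace of the vectors along which a family `Λ` of operators tends to `0`. Two families of
functionals are treated this way: the pairings with the translates of a symbol, and with the
normalized kernels. -/
def vanishingSubmodule (Λ : ι → E →L[𝕜] F) (l : Filter ι) : Submodule 𝕜 E where
  carrier := {x | Tendsto (fun i => Λ i x) l (𝓝 0)}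
  add_mem' hx hy := by simpa only [mem_ofPred_eq, map_add, add_zero] using hx.add hy
  zero_mem' := by simp only [mem_ofPred_eq, map_zero, tendsto_const_nhds]
  smul_mem' c x hx := by simpa only [mem_ofPred_eq, map_smul, smul_zero] using hx.const_smul c

lemma mem_vanishingSubmodule {Λ : ι → E →L[𝕜] F} {l : Filter ι} {x : E} :
    x ∈ vanishingSubmodule Λ l ↔ Tendsto (fun i => Λ i x) l (𝓝 0) := Iff.rfl

lemma isClosed_vanishingSubmodule {Λ : ι → E →L[𝕜] F} {C : ℝ} (hΛ : ∀ i, ‖Λ i‖ ≤ C)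
    (l : Filter ι) : IsClosed (vanishingSubmodule Λ l : Set E) :=
  have hlip : UniformEquicontinuous fun i => ⇑(Λ i) :=
    LipschitzWith.uniformEquicontinuous _ C.toNNReal fun i =>
      (Λ i).lipschitz.weaken (norm_toNNReal (a := Λ i) ▸ Real.toNNReal_le_toNNReal (hΛ i))
  hlip.equicontinuous.isClosed_setOfPred_tendsto continuous_const

lemma tendsto_apply_of_mem_isCompact {Λ : ι → E →L[𝕜] F} {C : ℝ} (hΛ : ∀ i, ‖Λ i‖ ≤ C)
    {l : Filter ι} (h : ∀ y, Tendsto (fun i => Λ i y) l (𝓝 0)) {K : Set E} (hK : IsCompact K)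
    {x : ι → E} (hx : ∀ i, x i ∈ K) : Tendsto (fun i => Λ i (x i)) l (𝓝 0) := by
  refine (tendsto_iff_ultrafilter _ _ _).2 fun U hU => ?_
  obtain ⟨y, -, hy⟩ := hK.ultrafilter_le_nhds' (U.map x) (Ultrafilter.mem_map.2
    (univ_mem' hx))
  have hdiff : Tendsto (fun i => Λ i (x i - y)) U (𝓝 0) := by
    refine squeeze_zero_norm (fun i => (Λ i).le_of_opNorm_le (hΛ i) _) ?_
    simpa using ((tendsto_iff_norm_sub_tendsto_zero (f := x)).1 hy).const_mul C
  simpa using hdiff.add ((h y).mono_left hU)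

end VanishingSubmodule

lemma mem_submodule_of_analyticOnNhd [NontriviallyNormedField 𝕜] [NormedAddCommGroup E]
    [NormedSpace 𝕜 E] {f : 𝕜 → E} {U : Set 𝕜} {N : Submodule 𝕜 E} (hf : AnalyticOnNhd 𝕜 f U)
    (hN : IsClosed (N : Set E)) (hU : IsPreconnected U) {z₀ : 𝕜} (hz₀ : z₀ ∈ U)
    (h : ∃ᶠ z in 𝓝[≠] z₀, f z ∈ N) {z : 𝕜} (hz : z ∈ U) : f z ∈ N := by
  rw [← Submodule.Quotient.mk_eq_zero]
  refine (N.mkQL.comp_analyticOnNhd hf).eqOn_zero_of_preconnected_of_frequently_eq_zero hU hz₀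
    (h.mono fun w hw => ?_) hz
  exact (Submodule.Quotient.mk_eq_zero N).2 hw

lemma isCompactOperator_of_forall_norm_sub_le [NontriviallyNormedField 𝕜] [NormedAddCommGroup E]
    [NormedSpace 𝕜 E] [NormedAddCommGroup F] [NormedSpace 𝕜 F] [CompleteSpace F] {T : E →L[𝕜] F}
    (h : ∀ ε > 0, ∃ S : E →L[𝕜] F, IsCompactOperator S ∧ ‖T - S‖ ≤ ε) : IsCompactOperator T := by
  refine isClosed_setOfPred_isCompactOperator.closure_subset
    (mem_closure_iff_nhds_basis nhds_basis_closedBall |>.2 fun ε hε => ?_)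
  obtain ⟨S, hS, hTS⟩ := h ε hε
  exact ⟨S, hS, by rwa [mem_closedBall', dist_eq_norm]⟩

section InnerProductSpace

variable [RCLike 𝕜] [NormedAddCommGroup E] [InnerProductSpace 𝕜 E]

lemma tendsto_inner_apply_of_isCompactOperator {S : E →L[𝕜] E} (hS : IsCompactOperator S)
    {k : ι → E} {C : ℝ} (hk : ∀ i, ‖k i‖ ≤ C) {l : Filter ι}
    (hk₀ : ∀ y, Tendsto (fun i => inner 𝕜 (k i) y) l (𝓝 0)) :
    Tendsto (fun i => inner 𝕜 (k i) (S (k i))) l (𝓝 0) := by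
  have hK := IsCompactOperator.isCompact_closure_image_closedBall (f := (S : E →ₗ[𝕜] E)) hS C
  refine tendsto_apply_of_mem_isCompact (Λ := fun i => innerSL 𝕜 (k i)) (C := C)
    (fun i => by simpa using hk i) hk₀ hK fun i => subset_closure ⟨k i, ?_, rfl⟩
  simpa using hk i

/-- Up to `ε`, only the finitely many functionals `⟪k, ·⟫` with `k` in an `ε`-net of `t` matter, so
`S` is approximated by its composition with the projection onto the span of the net. -/
lemma isCompactOperator_of_totallyBounded [NormedAddCommGroup F] [NormedSpace 𝕜 F]
    [CompleteSpace F] {t : Set E} (ht : TotallyBounded t) {S : E →L[𝕜] F}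
    (hS : ∀ f : E, ∀ δ : ℝ, 0 ≤ δ → (∀ k ∈ t, ‖inner 𝕜 k f‖ ≤ δ) → ‖S f‖ ≤ δ) :
    IsCompactOperator S := by
  refine isCompactOperator_of_forall_norm_sub_le fun ε hε => ?_
  obtain ⟨s, hs, hts⟩ := Metric.totallyBounded_iff.1 ht ε hε
  let V : Submodule 𝕜 E := Submodule.span 𝕜 s
  have : FiniteDimensional 𝕜 V := FiniteDimensional.span_of_finite 𝕜 hs
  have hV : IsCompactOperator V.starProjection :=
    (isCompactOperator_of_locallyCompactSpace_dom V.orthogonalProjectionOnto).clm_comp V.subtypeL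
  refine ⟨S ∘L V.starProjection, hV.clm_comp S,
    ContinuousLinearMap.opNorm_le_bound _ hε.le fun f => ?_⟩
  rw [sub_apply, ContinuousLinearMap.comp_apply, ← map_sub]
  refine hS _ _ (by positivity) fun k hk => ?_
  obtain ⟨k', hk', hkk'⟩ := mem_iUnion₂.1 (hts hk)
  have horth : inner 𝕜 k' (f - V.starProjection f) = 0 :=
    V.inner_right_of_mem_orthogonal (Submodule.subset_span hk')
      (V.sub_starProjection_mem_orthogonal f)
  calc ‖inner 𝕜 k (f - V.starProjection f)‖
      = ‖inner 𝕜 (k - k') (f - V.starProjection f)‖ := by rw [inner_sub_left, horth, sub_zero]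
    _ ≤ ‖k - k'‖ * ‖f - V.starProjection f‖ := norm_inner_le_norm _ _
    _ ≤ ε * ‖f‖ := by
        gcongr
        · exact (dist_eq_norm k k' ▸ mem_ball.1 hkk').le
        · rw [← Submodule.starProjection_orthogonal_val]
          exact Submodule.norm_starProjection_apply_le _ _

end InnerProductSpace

end FunctionalAnalysis

/-! ### Integral estimates -/

section Integrals

variable {α β ι E : Type*} {_ : MeasurableSpace α} {_ : MeasurableSpace β} {μ : Measure α}
  {ν : Measure β}

lemma tendsto_eLpNorm_zero_of_dominated [NormedAddCommGroup E] {p : ℝ≥0∞} (hp₀ : p ≠ 0)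
    (hp : p ≠ ∞) {l : Filter ι} [l.IsCountablyGenerated] {f : ι → α → E} {g : α → ℝ}
    (hf : ∀ i, StronglyMeasurable (f i)) (hg : MemLp g p μ)
    (hfg : ∀ i, ∀ᵐ x ∂μ, ‖f i x‖ ≤ g x)
    (hlim : ∀ᵐ x ∂μ, Tendsto (fun i => f i x) l (𝓝 0)) :
    Tendsto (fun i => eLpNorm (f i) p μ) l (𝓝 0) := by
  have hp' : 0 < p.toReal := ENNReal.toReal_pos hp₀ hp
  have hint : Tendsto (fun i => ∫⁻ x, ‖f i x‖ₑ ^ p.toReal ∂μ) l (𝓝 (∫⁻ _, 0 ∂μ)) := by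
    refine tendsto_lintegral_filter_of_dominated_convergence (fun x => ‖g x‖ₑ ^ p.toReal)
      (.of_forall fun i => (hf i).enorm.pow_const _) (.of_forall fun i => ?_)
      (lintegral_rpow_enorm_lt_top_of_eLpNorm_lt_top hp₀ hp hg.2).ne ?_
    · filter_upwards [hfg i] with x hx
      gcongr
      exact enorm_le_iff_norm_le.2 (hx.trans (le_abs_self _))
    · filter_upwards [hlim] with x hx
      simpa [hp'] using hx.enorm.ennrpow_const p.toReal
  simpa [eLpNorm_eq_lintegral_rpow_enorm_toReal hp₀ hp, hp'] using
    hint.ennrpow_const (1 / p.toReal)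

lemma lintegral_mul_sq_le {f g : α → ℝ≥0∞} (hf : AEMeasurable f μ) (hg : AEMeasurable g μ) :
    (∫⁻ x, f x * g x ∂μ) ^ 2 ≤ (∫⁻ x, f x ^ 2 ∂μ) * ∫⁻ x, g x ^ 2 ∂μ := by
  refine (pow_le_pow_left' (ENNReal.lintegral_mul_le_Lp_mul_Lq μ .two_two hf hg) 2).trans_eq ?_
  rw [mul_pow, ← ENNReal.rpow_natCast, ← ENNReal.rpow_natCast, ← ENNReal.rpow_mul,
    ← ENNReal.rpow_mul]
  norm_num

/-- The Cauchy–Schwarz inequality in the splitting `k F = (k q)^(1/2) (k q⁻¹ F²)^(1/2)`. -/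
lemma lintegral_mul_sq_le_of_weight {k q F : β → ℝ≥0∞} (hk : Measurable k) (hq : Measurable q)
    (hF : Measurable F) (hq₀ : ∀ᵐ z ∂ν, q z ≠ 0) (hq_top : ∀ᵐ z ∂ν, q z ≠ ∞) :
    (∫⁻ z, k z * F z ∂ν) ^ 2 ≤
      (∫⁻ z, k z * q z ∂ν) * ∫⁻ z, k z * ((q z)⁻¹ * F z ^ 2) ∂ν := by
  have hsqrt : ∀ x : ℝ≥0∞, (x ^ (1 / 2 : ℝ)) ^ 2 = x := fun x => by
    rw [← ENNReal.rpow_natCast, ← ENNReal.rpow_mul]; norm_num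
  have hsplit : ∫⁻ z, k z * F z ∂ν =
      ∫⁻ z, (k z * q z) ^ (1 / 2 : ℝ) * ((k z * ((q z)⁻¹ * F z ^ 2)) ^ (1 / 2 : ℝ)) ∂ν := by
    refine lintegral_congr_ae ?_
    filter_upwards [hq₀, hq_top] with z hz₀ hz
    have hsq : k z * q z * (k z * ((q z)⁻¹ * F z ^ 2)) = (k z * F z) ^ (2 : ℝ) := by
      rw [ENNReal.rpow_two, mul_pow, mul_mul_mul_comm, ← mul_assoc (q z),
        ENNReal.mul_inv_cancel hz₀ hz, one_mul, sq (k z)]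
    rw [← ENNReal.mul_rpow_of_nonneg _ _ (by norm_num), hsq, ← ENNReal.rpow_mul]
    norm_num
  rw [hsplit]
  refine (lintegral_mul_sq_le (by fun_prop) (by fun_prop)).trans_eq ?_
  simp_rw [hsqrt]

lemma lintegral_lintegral_mul_sq_le_of_schur [SFinite μ] [SFinite ν] {k : α → β → ℝ≥0∞}
    {p : α → ℝ≥0∞} {q F : β → ℝ≥0∞} {A B : ℝ≥0∞} (hk : Measurable (Function.uncurry k))
    (hp : Measurable p) (hq : Measurable q) (hF : Measurable F) (hq₀ : ∀ᵐ z ∂ν, q z ≠ 0)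
    (hq_top : ∀ᵐ z ∂ν, q z ≠ ∞) (hA : ∀ᵐ w ∂μ, ∫⁻ z, k w z * q z ∂ν ≤ A * p w)
    (hB : ∀ᵐ z ∂ν, ∫⁻ w, k w z * p w ∂μ ≤ B * q z) :
    ∫⁻ w, (∫⁻ z, k w z * F z ∂ν) ^ 2 ∂μ ≤ A * B * ∫⁻ z, F z ^ 2 ∂ν := by
  have hk_left : ∀ w, Measurable (k w) := fun w => hk.of_uncurry_left
  have hk_right : ∀ z, Measurable fun w => k w z := fun z => hk.of_uncurry_right
  let G : α → β → ℝ≥0∞ := fun w z => k w z * p w * ((q z)⁻¹ * F z ^ 2)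
  have hG : Measurable (Function.uncurry G) :=
    (hk.mul (hp.comp measurable_fst)).mul
      ((hq.comp measurable_snd).inv.mul ((hF.comp measurable_snd).pow_const 2))
  have hw : ∀ᵐ w ∂μ, (∫⁻ z, k w z * F z ∂ν) ^ 2 ≤ A * ∫⁻ z, G w z ∂ν := by
    filter_upwards [hA] with w hw
    refine (lintegral_mul_sq_le_of_weight (hk_left w) hq hF hq₀ hq_top).trans ?_
    have hmeas : Measurable fun z => k w z * ((q z)⁻¹ * F z ^ 2) := by fun_prop
    calc _ ≤ A * p w * ∫⁻ z, k w z * ((q z)⁻¹ * F z ^ 2) ∂ν := by gcongr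
      _ = A * ∫⁻ z, G w z ∂ν := by
          rw [mul_assoc, ← lintegral_const_mul _ hmeas]
          congr 2 with z
          simp only [G]
          ring
  have hz : ∀ᵐ z ∂ν, ∫⁻ w, G w z ∂μ ≤ B * F z ^ 2 := by
    filter_upwards [hB, hq₀, hq_top] with z hz hz₀ hz_top
    calc _ = (∫⁻ w, k w z * p w ∂μ) * ((q z)⁻¹ * F z ^ 2) :=
          lintegral_mul_const _ ((hk_right z).mul hp)
      _ ≤ B * q z * ((q z)⁻¹ * F z ^ 2) := by gcongr
      _ = B * F z ^ 2 := by
          rw [mul_assoc, ← mul_assoc (q z), ENNReal.mul_inv_cancel hz₀ hz_top, one_mul]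
  calc _ ≤ ∫⁻ w, A * ∫⁻ z, G w z ∂ν ∂μ := lintegral_mono_ae hw
    _ = A * ∫⁻ z, ∫⁻ w, G w z ∂μ ∂ν := by
        rw [lintegral_const_mul _ hG.lintegral_prod_right, lintegral_lintegral_swap hG.aemeasurable]
    _ ≤ A * ∫⁻ z, B * F z ^ 2 ∂ν := by gcongr 1; exact lintegral_mono_ae hz
    _ = A * B * ∫⁻ z, F z ^ 2 ∂ν := by rw [lintegral_const_mul _ (hF.pow_const 2), mul_assoc]

end Integrals

/-! ### Möbius involutions of the disk -/

/-- The involutive automorphism `φ_z` of the unit disk that exchanges `0` and `z`. -/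
def moebius (z w : ℂ) : ℂ := (z - w) / (1 - conj z * w)

lemma one_sub_norm_le_norm_one_sub_mul {a b : ℂ} (ha : ‖a‖ ≤ 1) : 1 - ‖b‖ ≤ ‖1 - a * b‖ := by
  have htri := norm_sub_norm_le (1 : ℂ) (a * b)
  rw [norm_one, norm_mul] at htri
  nlinarith [norm_nonneg b]

lemma one_sub_norm_left_le_norm_one_sub_conj_mul {a b : ℂ} (hb : ‖b‖ ≤ 1) :
    1 - ‖a‖ ≤ ‖1 - conj a * b‖ := by
  simpa [mul_comm] using one_sub_norm_le_norm_one_sub_mul (b := conj a) hb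

lemma one_sub_norm_right_le_norm_one_sub_conj_mul {a b : ℂ} (ha : ‖a‖ ≤ 1) :
    1 - ‖b‖ ≤ ‖1 - conj a * b‖ :=
  one_sub_norm_le_norm_one_sub_mul (by simpa using ha)

lemma one_sub_mul_ne_zero {a b : ℂ} (ha : ‖a‖ < 1) (hb : ‖b‖ < 1) : 1 - a * b ≠ 0 := by
  have := one_sub_norm_le_norm_one_sub_mul (b := b) ha.le
  exact norm_pos_iff.1 (by linarith)

lemma one_sub_conj_mul_ne_zero {a b : ℂ} (ha : ‖a‖ < 1) (hb : ‖b‖ < 1) : 1 - conj a * b ≠ 0 :=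
  one_sub_mul_ne_zero (by simpa using ha) hb

lemma one_sub_mul_conj_ne_zero {a b : ℂ} (ha : ‖a‖ < 1) (hb : ‖b‖ < 1) : 1 - a * conj b ≠ 0 :=
  one_sub_mul_ne_zero ha (by simpa using hb)

lemma one_sub_norm_sq_pos {z : ℂ} (hz : ‖z‖ < 1) : 0 < 1 - ‖z‖ ^ 2 := by
  nlinarith [norm_nonneg z]

lemma one_sub_norm_sq_ne_zero {z : ℂ} (hz : ‖z‖ < 1) : (1 - (‖z‖ : ℂ) ^ 2) ≠ 0 := by
  exact_mod_cast (one_sub_norm_sq_pos hz).ne'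

lemma norm_one_sub_norm_sq {z : ℂ} (hz : ‖z‖ < 1) : ‖(1 - (‖z‖ : ℂ) ^ 2)‖ = 1 - ‖z‖ ^ 2 := by
  rw [← Complex.ofReal_one, ← Complex.ofReal_pow, ← Complex.ofReal_sub, Complex.norm_real,
    Real.norm_of_nonneg (one_sub_norm_sq_pos hz).le]

lemma one_sub_conj_moebius_mul_moebius {z a b : ℂ} (hz : ‖z‖ < 1) (ha : ‖a‖ < 1) (hb : ‖b‖ < 1) :
    1 - conj (moebius z a) * moebius z b =
      (1 - (‖z‖ : ℂ) ^ 2) * (1 - conj a * b) / ((1 - z * conj a) * (1 - conj z * b)) := by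
  have hza := one_sub_mul_conj_ne_zero hz ha
  have hzb := one_sub_conj_mul_ne_zero hz hb
  rw [← Complex.mul_conj']
  simp only [moebius, map_div₀, map_sub, map_one, map_mul, Complex.conj_conj]
  rw [div_mul_div_comm, eq_div_iff (mul_ne_zero hza hzb), sub_mul,
    div_mul_cancel₀ _ (mul_ne_zero hza hzb)]
  ring

lemma one_sub_norm_moebius_sq {z a : ℂ} (hz : ‖z‖ < 1) (ha : ‖a‖ < 1) :
    1 - ‖moebius z a‖ ^ 2 = (1 - ‖z‖ ^ 2) * (1 - ‖a‖ ^ 2) / ‖1 - conj z * a‖ ^ 2 := by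
  have h := one_sub_conj_moebius_mul_moebius hz ha ha
  rw [Complex.conj_mul', Complex.conj_mul', show 1 - z * conj a = conj (1 - conj z * a) by simp,
    Complex.conj_mul'] at h
  exact_mod_cast h

lemma norm_moebius_lt_one {z a : ℂ} (hz : ‖z‖ < 1) (ha : ‖a‖ < 1) : ‖moebius z a‖ < 1 := by
  have hza := norm_pos_iff.2 (one_sub_conj_mul_ne_zero hz ha)
  have hz₀ := one_sub_norm_sq_pos hz
  have ha₀ := one_sub_norm_sq_pos ha
  have hpos : 0 < 1 - ‖moebius z a‖ ^ 2 := by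
    rw [one_sub_norm_moebius_sq hz ha]
    positivity
  nlinarith [norm_nonneg (moebius z a)]

@[simp] lemma moebius_zero_right (z : ℂ) : moebius z 0 = z := by simp [moebius]

lemma one_sub_conj_mul_moebius {z a : ℂ} (hz : ‖z‖ < 1) (ha : ‖a‖ < 1) :
    1 - conj z * moebius z a = (1 - (‖z‖ : ℂ) ^ 2) / (1 - conj z * a) := by
  simpa using one_sub_conj_moebius_mul_moebius (a := 0) hz (by simp) ha

lemma moebius_moebius {z a : ℂ} (hz : ‖z‖ < 1) (ha : ‖a‖ < 1) : moebius z (moebius z a) = a := by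
  rw [moebius, one_sub_conj_mul_moebius hz ha, moebius, div_div_eq_mul_div,
    div_eq_iff (one_sub_norm_sq_ne_zero hz), sub_mul,
    div_mul_cancel₀ _ (one_sub_conj_mul_ne_zero hz ha), ← Complex.mul_conj']
  ring

lemma hasDerivAt_moebius {z a : ℂ} (hz : ‖z‖ < 1) (ha : ‖a‖ < 1) :
    HasDerivAt (moebius z) (-(1 - (‖z‖ : ℂ) ^ 2) / (1 - conj z * a) ^ 2) a := by
  refine (((hasDerivAt_id a).const_sub z).div
    (((hasDerivAt_id a).const_mul (conj z)).const_sub 1)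
    (one_sub_conj_mul_ne_zero hz ha)).congr_deriv ?_
  rw [← Complex.mul_conj']
  simp only [id]
  ring

lemma measurable_moebius (z : ℂ) : Measurable (moebius z) := by
  unfold moebius
  fun_prop

lemma image_moebius_ball {z : ℂ} (hz : ‖z‖ < 1) : moebius z '' ball 0 1 = ball 0 1 := by
  ext w
  simp only [mem_image, mem_ball_zero_iff]
  exact ⟨fun ⟨a, ha, h⟩ => h ▸ norm_moebius_lt_one hz ha,
    fun hw => ⟨moebius z w, norm_moebius_lt_one hz hw, moebius_moebius hz hw⟩⟩

lemma injOn_moebius {z : ℂ} (hz : ‖z‖ < 1) : InjOn (moebius z) (ball 0 1) := by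
  intro a ha b hb h
  rw [mem_ball_zero_iff] at ha hb
  rw [← moebius_moebius hz ha, h, moebius_moebius hz hb]

/-! ### Change of variables -/

lemma ae_norm_lt_one : ∀ᵐ w ∂diskMeasure, ‖w‖ < 1 := by
  have hball : ∀ᵐ w ∂diskMeasure, w ∈ ball (0 : ℂ) 1 :=
    Measure.ae_smul_measure (ae_restrict_mem isOpen_ball.measurableSet) _
  simpa only [mem_ball_zero_iff] using hball

lemma lintegral_diskMeasure (f : ℂ → ℝ≥0∞) :
    ∫⁻ w, f w ∂diskMeasure = (volume (ball (0 : ℂ) 1))⁻¹ * ∫⁻ w in ball 0 1, f w := by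
  rw [diskMeasure, lintegral_smul_measure, smul_eq_mul]

lemma integral_diskMeasure (f : ℂ → ℂ) :
    ∫ w, f w ∂diskMeasure = ((volume (ball (0 : ℂ) 1))⁻¹).toReal • ∫ w in ball 0 1, f w := by
  rw [diskMeasure, integral_smul_measure]

lemma integrable_diskMeasure_iff (f : ℂ → ℂ) :
    Integrable f diskMeasure ↔ IntegrableOn f (ball 0 1) := by
  rw [diskMeasure, integrable_smul_measure, IntegrableOn]
  · exact ENNReal.inv_ne_zero.2 measure_ball_lt_top.ne
  · exact ENNReal.inv_ne_top.2 (measure_ball_pos volume _ one_pos).ne'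

lemma abs_det_toSpanSingleton_restrictScalars (c : ℂ) :
    |((ContinuousLinearMap.toSpanSingleton ℂ c).restrictScalars ℝ).det| = ‖c‖ ^ 2 := by
  have hc : (ContinuousLinearMap.toSpanSingleton ℂ c).toLinearMap = c • LinearMap.id := by
    ext; simp
  rw [ContinuousLinearMap.det, ContinuousLinearMap.coe_restrictScalars, hc,
    LinearMap.det_restrictScalars]
  simp [Algebra.norm_complex_apply, Complex.normSq_eq_norm_sq]

/-- The Jacobian `|φ_z'(a)|²` of `φ_z`, viewed as a map of the real plane. -/
def moebiusJac (z a : ℂ) : ℝ := (1 - ‖z‖ ^ 2) ^ 2 / ‖1 - conj z * a‖ ^ 4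

lemma abs_det_moebius {z a : ℂ} (hz : ‖z‖ < 1) :
    |((ContinuousLinearMap.toSpanSingleton ℂ
      (-(1 - (‖z‖ : ℂ) ^ 2) / (1 - conj z * a) ^ 2)).restrictScalars ℝ).det| = moebiusJac z a := by
  rw [abs_det_toSpanSingleton_restrictScalars, norm_div, norm_neg, norm_pow,
    norm_one_sub_norm_sq hz, moebiusJac, div_pow]
  ring

lemma hasFDerivWithinAt_moebius {z a : ℂ} (hz : ‖z‖ < 1) (ha : a ∈ ball (0 : ℂ) 1) :
    HasFDerivWithinAt (moebius z) ((ContinuousLinearMap.toSpanSingleton ℂ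
      (-(1 - (‖z‖ : ℂ) ^ 2) / (1 - conj z * a) ^ 2)).restrictScalars ℝ) (ball 0 1) a :=
  ((hasDerivAt_moebius hz (mem_ball_zero_iff.1 ha)).hasFDerivAt.restrictScalars
    ℝ).hasFDerivWithinAt

lemma lintegral_eq_lintegral_moebius {z : ℂ} (hz : ‖z‖ < 1) (f : ℂ → ℝ≥0∞) :
    ∫⁻ w, f w ∂diskMeasure =
      ∫⁻ a, ENNReal.ofReal (moebiusJac z a) * f (moebius z a) ∂diskMeasure := by
  rw [lintegral_diskMeasure, lintegral_diskMeasure]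
  congr 1
  conv_lhs => rw [← image_moebius_ball hz]
  rw [lintegral_image_eq_lintegral_abs_det_fderiv_mul volume isOpen_ball.measurableSet
    (fun a ha => hasFDerivWithinAt_moebius hz ha) (injOn_moebius hz)]
  simp_rw [abs_det_moebius hz]

lemma integral_eq_integral_moebius {z : ℂ} (hz : ‖z‖ < 1) (f : ℂ → ℂ) :
    ∫ w, f w ∂diskMeasure = ∫ a, moebiusJac z a • f (moebius z a) ∂diskMeasure := by
  rw [integral_diskMeasure, integral_diskMeasure]
  congr 1
  conv_lhs => rw [← image_moebius_ball hz]
  rw [integral_image_eq_integral_abs_det_fderiv_smul volume isOpen_ball.measurableSet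
    (fun a ha => hasFDerivWithinAt_moebius hz ha) (injOn_moebius hz)]
  simp_rw [abs_det_moebius hz]

lemma integrable_iff_integrable_moebius {z : ℂ} (hz : ‖z‖ < 1) (f : ℂ → ℂ) :
    Integrable f diskMeasure ↔
      Integrable (fun a => moebiusJac z a • f (moebius z a)) diskMeasure := by
  rw [integrable_diskMeasure_iff, integrable_diskMeasure_iff]
  conv_lhs => rw [← image_moebius_ball hz]
  rw [integrableOn_image_iff_integrableOn_abs_det_fderiv_smul volume isOpen_ball.measurableSet
    (fun a ha => hasFDerivWithinAt_moebius hz ha) (injOn_moebius hz)]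
  simp_rw [abs_det_moebius hz]

/-! ### The area mean value property -/

lemma measurePreserving_mul_diskMeasure {c : ℂ} (hc : ‖c‖ = 1) :
    MeasurePreserving (c * ·) diskMeasure diskMeasure := by
  have hrot : MeasurePreserving (c * · : ℂ → ℂ) :=
    (rotation (⟨c, mem_sphere_zero_iff_norm.2 hc⟩ : Circle)).measurePreserving
  have hball : (c * · : ℂ → ℂ) ⁻¹' ball 0 1 = ball 0 1 := by
    ext w; simp [hc]
  have hrestrict := hrot.restrict_preimage (s := ball 0 1) isOpen_ball.measurableSet
  rw [hball] at hrestrict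
  exact hrestrict.smul_measure _

lemma integral_circleAverage_comp_mul {E : Type*} [NormedAddCommGroup E] [NormedSpace ℝ E]
    [CompleteSpace E] {μ : Measure ℂ} [SFinite μ]
    (hμ : ∀ c : ℂ, ‖c‖ = 1 → MeasurePreserving (c * ·) μ μ) {g : ℂ → E} (hg : Integrable g μ) :
    ∫ w, Real.circleAverage (fun ζ => g (ζ * w)) 0 1 ∂μ = ∫ w, g w ∂μ := by
  have hcirc (θ : ℝ) : ‖circleMap 0 1 θ‖ = 1 := by simp
  have hrot (θ : ℝ) : ∫ w, g (circleMap 0 1 θ * w) ∂μ = ∫ w, g w ∂μ :=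
    (hμ _ (hcirc θ)).integral_comp
      (measurableEmbedding_mulLeft₀ (norm_pos_iff.1 ((hcirc θ).symm ▸ one_pos))) g
  have hskew : MeasurePreserving (fun p : ℝ × ℂ => (p.1, circleMap 0 1 p.1 * p.2))
      ((volume.restrict (Ioc 0 (2 * Real.pi))).prod μ)
      ((volume.restrict (Ioc 0 (2 * Real.pi))).prod μ) :=
    (MeasurePreserving.id _).skew_product (g := fun θ w => circleMap 0 1 θ * w)
      (((continuous_circleMap 0 1).measurable.comp measurable_fst).mul measurable_snd)
      (Eventually.of_forall fun θ => (hμ _ (hcirc θ)).map_eq)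
  have hint : Integrable (Function.uncurry fun (θ : ℝ) (w : ℂ) => g (circleMap 0 1 θ * w))
      ((volume.restrict (Ioc 0 (2 * Real.pi))).prod μ) :=
    hskew.integrable_comp_of_integrable (hg.comp_snd _)
  simp_rw [Real.circleAverage_def, intervalIntegral.integral_of_le Real.two_pi_pos.le]
  rw [integral_smul, ← integral_integral_swap hint, funext hrot, integral_const,
    measureReal_restrict_apply_univ, Real.volume_real_Ioc_of_le Real.two_pi_pos.le, sub_zero,
    smul_smul, inv_mul_cancel₀ Real.two_pi_pos.ne', one_smul]

lemma circleAverage_comp_mul {E : Type*} [NormedAddCommGroup E] [NormedSpace ℂ E]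
    [CompleteSpace E] {g : ℂ → E} (hg : DifferentiableOn ℂ g (ball 0 1)) {w : ℂ}
    (hw : ‖w‖ < 1) : Real.circleAverage (fun ζ => g (ζ * w)) 0 1 = g 0 := by
  have hmaps : MapsTo (· * w) (closedBall (0 : ℂ) 1) (ball 0 1) := by
    intro ζ hζ
    rw [mem_closedBall_zero_iff] at hζ
    rw [mem_ball_zero_iff, norm_mul]
    nlinarith [norm_nonneg w]
  have hd : DifferentiableOn ℂ (fun ζ => g (ζ * w)) (closedBall 0 |1|) := by
    rw [abs_one]
    exact hg.comp (by fun_prop) hmaps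
  simpa using (hd.diffContOnCl_ball subset_rfl).circleAverage

lemma integral_diskMeasure_eq_apply_zero {g : ℂ → ℂ} (hg : DifferentiableOn ℂ g (ball 0 1))
    (hi : Integrable g diskMeasure) : ∫ w, g w ∂diskMeasure = g 0 := by
  rw [← integral_circleAverage_comp_mul (fun _ => measurePreserving_mul_diskMeasure) hi,
    integral_congr_ae (ae_norm_lt_one.mono fun w => circleAverage_comp_mul hg)]
  simp

/-! ### The Bergman kernel in closed form -/

/-- The function `w ↦ (1 - z̄ w)⁻²`, the analytic representative of the kernel `K_z`. -/
def kernelFun (z w : ℂ) : ℂ := ((1 - conj z * w) ^ 2)⁻¹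

lemma measurable_kernelFun (z : ℂ) : Measurable (kernelFun z) := by
  unfold kernelFun; fun_prop

@[simp] lemma kernelFun_zero_left (w : ℂ) : kernelFun 0 w = 1 := by simp [kernelFun]

lemma measurable_conj_kernelFun (z : ℂ) : Measurable fun w => conj (kernelFun z w) :=
  Complex.continuous_conj.measurable.comp (measurable_kernelFun z)

lemma kernelFun_self (z : ℂ) : kernelFun z z = (((1 - ‖z‖ ^ 2) ^ 2)⁻¹ : ℝ) := by
  simp [kernelFun, Complex.conj_mul']

lemma norm_kernelFun (z w : ℂ) : ‖kernelFun z w‖ = (‖1 - conj z * w‖ ^ 2)⁻¹ := by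
  simp [kernelFun]

lemma norm_kernelFun_le {z w : ℂ} (hz : ‖z‖ < 1) (hw : ‖w‖ ≤ 1) :
    ‖kernelFun z w‖ ≤ ((1 - ‖z‖) ^ 2)⁻¹ := by
  have hlow := one_sub_norm_left_le_norm_one_sub_conj_mul (a := z) hw
  rw [norm_kernelFun]
  gcongr

lemma differentiableOn_kernelFun {z : ℂ} (hz : ‖z‖ < 1) :
    DifferentiableOn ℂ (kernelFun z) (ball 0 1) := by
  unfold kernelFun
  refine DifferentiableOn.inv (by fun_prop) fun w hw => ?_
  exact pow_ne_zero _ (one_sub_conj_mul_ne_zero hz (mem_ball_zero_iff.1 hw))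

lemma ae_norm_kernelFun_le {z : ℂ} (hz : ‖z‖ < 1) :
    ∀ᵐ w ∂diskMeasure, ‖kernelFun z w‖ ≤ ((1 - ‖z‖) ^ 2)⁻¹ := by
  filter_upwards [ae_norm_lt_one] with w hw using norm_kernelFun_le hz hw.le

lemma memLp_kernelFun {z : ℂ} (hz : ‖z‖ < 1) (p : ℝ≥0∞) : MemLp (kernelFun z) p diskMeasure :=
  MemLp.of_bound (measurable_kernelFun z).aestronglyMeasurable _ (ae_norm_kernelFun_le hz)

lemma conj_one_sub_norm_sq (z : ℂ) : conj (1 - (‖z‖ : ℂ) ^ 2) = 1 - (‖z‖ : ℂ) ^ 2 := by simp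

lemma kernelFun_moebius_moebius {z a b : ℂ} (hz : ‖z‖ < 1) (ha : ‖a‖ < 1) (hb : ‖b‖ < 1) :
    kernelFun (moebius z a) (moebius z b) =
      ((1 - z * conj a) * (1 - conj z * b)) ^ 2 / (1 - (‖z‖ : ℂ) ^ 2) ^ 2 * kernelFun a b := by
  rw [kernelFun, one_sub_conj_moebius_mul_moebius hz ha hb, kernelFun, div_pow,
    mul_pow (1 - (‖z‖ : ℂ) ^ 2), inv_div, div_mul_eq_div_mul_one_div]
  ring

lemma kernelFun_moebius {z b : ℂ} (hz : ‖z‖ < 1) (hb : ‖b‖ < 1) :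
    kernelFun z (moebius z b) = (1 - conj z * b) ^ 2 / (1 - (‖z‖ : ℂ) ^ 2) ^ 2 := by
  simpa using kernelFun_moebius_moebius (a := 0) hz (by simp) hb

lemma moebiusJac_eq (z b : ℂ) : (moebiusJac z b : ℂ) =
    (1 - (‖z‖ : ℂ) ^ 2) ^ 2 / ((1 - conj z * b) ^ 2 * conj ((1 - conj z * b) ^ 2)) := by
  rw [Complex.mul_conj', moebiusJac, norm_pow]
  push_cast
  ring

lemma moebiusJac_smul_conj_kernelFun {z a : ℂ} (hz : ‖z‖ < 1) (ha : ‖a‖ < 1) :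
    moebiusJac z a • conj (kernelFun z (moebius z a)) = kernelFun z a := by
  have hza := one_sub_conj_mul_ne_zero hz ha
  have hza' : conj (1 - conj z * a) ≠ 0 := (map_ne_zero _).2 hza
  have hz₀ := one_sub_norm_sq_ne_zero hz
  rw [Complex.real_smul, kernelFun_moebius hz ha, moebiusJac_eq, kernelFun, map_div₀, map_pow,
    map_pow, conj_one_sub_norm_sq]
  field_simp

/- Since `K_0 = 1`, the case `z = 0` is the mean value property; the change of variables `φ_z`
moves the general case to it, because its Jacobian turns `conj (K_z ∘ φ_z)` into the analytic
function `K_z`. -/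
lemma integral_conj_kernelFun_mul {g : ℂ → ℂ} (hg : DifferentiableOn ℂ g (ball 0 1))
    (hi : Integrable g diskMeasure) {z : ℂ} (hz : ‖z‖ < 1) :
    ∫ w, conj (kernelFun z w) * g w ∂diskMeasure = g z := by
  have hpull : ∀ᵐ a ∂diskMeasure,
      moebiusJac z a • (conj (kernelFun z (moebius z a)) * g (moebius z a)) =
      kernelFun z a * g (moebius z a) := by
    filter_upwards [ae_norm_lt_one] with a ha
    rw [← smul_mul_assoc, moebiusJac_smul_conj_kernelFun hz ha]
  have hint : Integrable (fun w => conj (kernelFun z w) * g w) diskMeasure :=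
    hi.bdd_mul (measurable_conj_kernelFun z).aestronglyMeasurable
      (by simpa using ae_norm_kernelFun_le hz)
  have hdiff : DifferentiableOn ℂ (fun a => kernelFun z a * g (moebius z a)) (ball 0 1) := by
    refine (differentiableOn_kernelFun hz).mul (hg.comp (fun a ha => ?_) fun a ha => ?_)
    · exact (hasDerivAt_moebius hz
        (mem_ball_zero_iff.1 ha)).differentiableAt.differentiableWithinAt
    · exact mem_ball_zero_iff.2 (norm_moebius_lt_one hz (mem_ball_zero_iff.1 ha))
  rw [integral_eq_integral_moebius hz, integral_congr_ae hpull,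
    integral_diskMeasure_eq_apply_zero hdiff
      (((integrable_iff_integrable_moebius hz _).1 hint).congr hpull)]
  simp [kernelFun]

lemma bergmanKernel_ae_eq (z : 𝔻) :
    (bergmanKernel z : Lp ℂ 2 diskMeasure) =ᵐ[diskMeasure] kernelFun z := by
  have hz := z.norm_lt_one
  have hk : ((memLp_kernelFun hz 2).toLp : Lp ℂ 2 diskMeasure) =ᵐ[diskMeasure] kernelFun z :=
    MemLp.coeFn_toLp _
  let k : bergmanSpace := ⟨(memLp_kernelFun hz 2).toLp, _, differentiableOn_kernelFun hz, hk⟩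
  suffices bergmanKernel z = k by rw [this]; exact hk
  refine ext_inner_right ℂ fun f => ?_
  have hrep := bergmanSpace.differentiableOn_rep f
  have hae := bergmanSpace.coe_ae_eq_rep f
  have hint : Integrable (bergmanSpace.rep f) diskMeasure :=
    ((Lp.memLp (f : Lp ℂ 2 diskMeasure)).integrable one_le_two).congr hae
  rw [inner_bergmanKernel, bergmanSpace.apply_eq hrep hae,
    ← integral_conj_kernelFun_mul hrep hint hz, Submodule.coe_inner, L2.inner_def]
  refine integral_congr_ae ?_
  filter_upwards [hk, hae] with w hkw hfw
  rw [hkw, hfw, RCLike.inner_apply, mul_comm]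

lemma bergmanKernel_apply (z w : 𝔻) : bergmanKernel z w = kernelFun z w :=
  bergmanSpace.apply_eq (differentiableOn_kernelFun z.norm_lt_one) (bergmanKernel_ae_eq z) w

lemma norm_bergmanKernel (z : 𝔻) : ‖bergmanKernel z‖ = (1 - ‖(z : ℂ)‖ ^ 2)⁻¹ := by
  have hpos := one_sub_norm_sq_pos z.norm_lt_one
  have hinner := inner_self_eq_norm_sq_to_K (𝕜 := ℂ) (bergmanKernel z)
  rw [inner_bergmanKernel, bergmanKernel_apply, kernelFun_self, ← inv_pow] at hinner
  refine (sq_eq_sq₀ (norm_nonneg _) (by positivity)).1 ?_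
  exact Complex.ofReal_injective (by simpa using hinner.symm)

lemma normalizedKernel_eq (z : 𝔻) :
    normalizedKernel z = (1 - (‖(z : ℂ)‖ : ℂ) ^ 2) • bergmanKernel z := by
  rw [normalizedKernel, norm_bergmanKernel]
  simp

lemma norm_normalizedKernel (z : 𝔻) : ‖normalizedKernel z‖ = 1 := by
  have hpos := one_sub_norm_sq_pos z.norm_lt_one
  rw [normalizedKernel_eq, norm_smul, norm_one_sub_norm_sq z.norm_lt_one, norm_bergmanKernel,
    mul_inv_cancel₀ hpos.ne']

/-! ### The integral kernel of a Toeplitz operator -/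

/-- The integral kernel of the Toeplitz operator with symbol `v`: its value is
`⟨T_v K_z, K_w⟩ = (T_v K_z)(w)`. -/
def toeplitzKernel (v : ℂ → ℂ) (w z : ℂ) : ℂ :=
  ∫ ζ, v ζ * (kernelFun z ζ * conj (kernelFun w ζ)) ∂diskMeasure

/-- The Berezin transform of a function, in terms of the unnormalized kernels. It depends on the
function itself only through its class modulo null sets, but unlike `berezinSymbol` it can be
applied to compositions with automorphisms of the disk. -/
def berezinTransform (v : ℂ → ℂ) (z : ℂ) : ℂ :=
  (1 - (‖z‖ : ℂ) ^ 2) ^ 2 * toeplitzKernel v z z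

lemma mulOp_ae_eq (u : Lp ℂ ∞ diskMeasure) (f : Lp ℂ 2 diskMeasure) :
    mulOp u f =ᵐ[diskMeasure] fun w => u w * f w :=
  (ContinuousLinearMap.mul ℂ ℂ).coeFn_holder (r := 2) u f

lemma norm_toeplitz_apply_le (u : Lp ℂ ∞ diskMeasure) (f : bergmanSpace) :
    ‖toeplitz u f‖ ≤ ‖mulOp u f‖ := by
  rw [toeplitz, ContinuousLinearMap.comp_apply, ContinuousLinearMap.comp_apply]
  exact Submodule.norm_orthogonalProjectionOnto_apply_le bergmanSpace _

lemma inner_toeplitz (u : Lp ℂ ∞ diskMeasure) (f g : bergmanSpace) :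
    inner ℂ f (toeplitz u g) =
      ∫ w, u w * ((g : Lp ℂ 2 diskMeasure) w * conj ((f : Lp ℂ 2 diskMeasure) w))
        ∂diskMeasure := by
  simp only [toeplitz, ContinuousLinearMap.comp_apply]
  rw [Submodule.inner_orthogonalProjectionOnto_eq_of_mem_left, L2.inner_def]
  refine integral_congr_ae ?_
  filter_upwards [mulOp_ae_eq u g] with w hw
  rw [Submodule.subtypeL_apply, hw, RCLike.inner_apply, mul_assoc]

lemma toeplitz_bergmanKernel_apply {u : Lp ℂ ∞ diskMeasure} {v : ℂ → ℂ}
    (huv : u =ᵐ[diskMeasure] v) (w z : 𝔻) :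
    toeplitz u (bergmanKernel z) w = toeplitzKernel v w z := by
  rw [← inner_bergmanKernel, inner_toeplitz, toeplitzKernel]
  refine integral_congr_ae ?_
  filter_upwards [huv, bergmanKernel_ae_eq z, bergmanKernel_ae_eq w] with ζ hu hz hw
  rw [hu, hz, hw]

lemma berezinSymbol_eq {u : Lp ℂ ∞ diskMeasure} {v : ℂ → ℂ}
    (huv : u =ᵐ[diskMeasure] v) (z : 𝔻) : berezinSymbol u z = berezinTransform v z := by
  rw [berezinSymbol, berezin, normalizedKernel_eq, map_smul,
    inner_smul_left (𝕜 := ℂ) (E := bergmanSpace), inner_smul_right (𝕜 := ℂ) (E := bergmanSpace),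
    inner_bergmanKernel, toeplitz_bergmanKernel_apply huv, conj_one_sub_norm_sq,
    berezinTransform]
  ring

lemma toeplitzKernel_moebius (v : ℂ → ℂ) {z a b : ℂ} (hz : ‖z‖ < 1) (ha : ‖a‖ < 1)
    (hb : ‖b‖ < 1) :
    toeplitzKernel v (moebius z a) (moebius z b) =
      ((1 - conj z * a) * (1 - z * conj b)) ^ 2 / (1 - (‖z‖ : ℂ) ^ 2) ^ 2 *
        toeplitzKernel (v ∘ moebius z) a b := by
  rw [toeplitzKernel, integral_eq_integral_moebius hz, toeplitzKernel, ← integral_const_mul]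
  refine integral_congr_ae ?_
  filter_upwards [ae_norm_lt_one] with ζ hζ
  have hzζ := one_sub_conj_mul_ne_zero hz hζ
  have hzζ' : conj (1 - conj z * ζ) ≠ 0 := (map_ne_zero _).2 hzζ
  have hz₀ := one_sub_norm_sq_ne_zero hz
  have ha' : conj (1 - z * conj a) = 1 - conj z * a := by simp
  rw [Complex.real_smul, kernelFun_moebius_moebius hz hb hζ, kernelFun_moebius_moebius hz ha hζ,
    moebiusJac_eq, Function.comp_apply]
  simp only [map_mul, map_div₀, map_pow, conj_one_sub_norm_sq, ha']
  field_simp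

lemma berezinTransform_moebius (v : ℂ → ℂ) {z a : ℂ} (hz : ‖z‖ < 1) (ha : ‖a‖ < 1) :
    berezinTransform v (moebius z a) = berezinTransform (v ∘ moebius z) a := by
  have hza := one_sub_mul_conj_ne_zero hz ha
  have hza' := one_sub_conj_mul_ne_zero hz ha
  have hz₀ := one_sub_norm_sq_ne_zero hz
  rw [berezinTransform, toeplitzKernel_moebius v hz ha ha, berezinTransform,
    ← Complex.conj_mul' (moebius z a), one_sub_conj_moebius_mul_moebius hz ha ha,
    Complex.conj_mul']
  field_simp

lemma ae_norm_le_norm_of_Lp_top {α E : Type*} [MeasurableSpace α] {μ : Measure α}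
    [NormedAddCommGroup E] (u : Lp E ∞ μ) : ∀ᵐ x ∂μ, ‖u x‖ ≤ ‖u‖ := by
  filter_upwards [ae_le_eLpNormEssSup (f := u) (μ := μ)] with x hx
  rw [← eLpNorm_exponent_top, ← Lp.enorm_def] at hx
  exact enorm_le_iff_norm_le.1 hx

lemma exists_stronglyMeasurable_norm_le_ae_eq {α E : Type*} [MeasurableSpace α] {μ : Measure α}
    [NormedAddCommGroup E] (u : Lp E ∞ μ) :
    ∃ v : α → E, StronglyMeasurable v ∧ (∀ x, ‖v x‖ ≤ ‖u‖) ∧ u =ᵐ[μ] v := by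
  have hu := Lp.stronglyMeasurable u
  refine ⟨{x | ‖u x‖ ≤ ‖u‖}.indicator u,
    hu.indicator (hu.norm.measurableSet_le stronglyMeasurable_const), fun x => ?_, ?_⟩
  · rw [norm_indicator_eq_indicator_norm]
    exact indicator_le' (fun _ hx => hx) (fun _ _ => norm_nonneg u) x
  · filter_upwards [ae_norm_le_norm_of_Lp_top u] with x hx
    exact (indicator_of_mem (s := {x | ‖u x‖ ≤ ‖u‖}) hx u).symm

/-! ### Approach to the boundary -/

/-- The automorphism `φ_z` as a map from the unit disk to itself. -/
def moebiusDisc (z a : 𝔻) : 𝔻 :=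
  Complex.UnitDisc.mk (moebius z a) (norm_moebius_lt_one z.norm_lt_one a.norm_lt_one)

@[simp] lemma coe_moebiusDisc (z a : 𝔻) : (moebiusDisc z a : ℂ) = moebius z a := rfl

lemma tendsto_norm_toBoundary : Tendsto (fun z : 𝔻 => ‖(z : ℂ)‖) toBoundary (𝓝 1) :=
  tendsto_comap

instance : toBoundary.IsCountablyGenerated := by
  unfold toBoundary; infer_instance

lemma one_sub_norm_moebius_sq_le {z a : ℂ} (hz : ‖z‖ < 1) (ha : ‖a‖ < 1) :
    1 - ‖moebius z a‖ ^ 2 ≤ (1 - ‖z‖ ^ 2) / (1 - ‖a‖) ^ 2 := by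
  have hlow := one_sub_norm_right_le_norm_one_sub_conj_mul (b := a) hz.le
  have hz₀ := (one_sub_norm_sq_pos hz).le
  rw [one_sub_norm_moebius_sq hz ha]
  gcongr
  nlinarith [sq_nonneg ‖a‖]

lemma tendsto_moebiusDisc (a : 𝔻) :
    Tendsto (fun z => moebiusDisc z a) toBoundary toBoundary := by
  refine tendsto_comap_iff.2 ?_
  have hlow : Tendsto (fun z : 𝔻 => 1 - (1 - ‖(z : ℂ)‖ ^ 2) / (1 - ‖(a : ℂ)‖) ^ 2)
      toBoundary (𝓝 1) := by
    simpa using (((tendsto_norm_toBoundary.pow 2).const_sub 1).div_const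
      ((1 - ‖(a : ℂ)‖) ^ 2)).const_sub 1
  refine tendsto_of_tendsto_of_tendsto_of_le_of_le hlow tendsto_const_nhds (fun z => ?_)
    fun z => (moebiusDisc z a).norm_lt_one.le
  have hle := one_sub_norm_moebius_sq_le z.norm_lt_one a.norm_lt_one
  have hlt := (moebiusDisc z a).norm_lt_one
  simp only [Function.comp_apply, coe_moebiusDisc] at hlt ⊢
  nlinarith [norm_nonneg (moebius z a)]

/-! ### Polarization -/

section Polarization

variable {E : Type*} [NormedAddCommGroup E] [NormedSpace ℂ E] [CompleteSpace E]
  {N : Submodule ℂ E}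

lemma mem_submodule_of_forall_real_mul_mem {f : ℂ → E} {U : Set ℂ} (hf : DifferentiableOn ℂ f U)
    (hU : IsOpen U) (hUc : IsPreconnected U) (hN : IsClosed (N : Set E)) (h₀ : (0 : ℂ) ∈ U)
    {d : ℂ} (hd : d ≠ 0) (h : ∀ r : ℝ, r * d ∈ U → f (r * d) ∈ N) {z : ℂ} (hz : z ∈ U) :
    f z ∈ N := by
  have hlim : Tendsto (fun r : ℝ => (r : ℂ) * d) (𝓝[≠] 0) (𝓝[≠] 0) := by
    refine tendsto_nhdsWithin_iff.2 ⟨?_, eventually_mem_nhdsWithin.mono fun r hr => ?_⟩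
    · exact (Continuous.tendsto' (by fun_prop) _ _ (by simp)).mono_left nhdsWithin_le_nhds
    · exact mul_ne_zero (Complex.ofReal_ne_zero.2 hr) hd
  refine mem_submodule_of_analyticOnNhd (hf.analyticOnNhd hU) hN hUc h₀
    (hlim.frequently (Eventually.frequently ?_)) hz
  filter_upwards [hlim.eventually (nhdsWithin_le_nhds (hU.mem_nhds h₀))] with r hr using h r hr

lemma norm_lt_one_of_norm_add_lt_one_of_norm_sub_lt_one {F : Type*} [NormedAddCommGroup F]
    [NormedSpace ℝ F] {p c : F} (hadd : ‖p + c‖ < 1) (hsub : ‖p - c‖ < 1) : ‖c‖ < 1 := by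
  have htri := norm_sub_le (p + c) (p - c)
  rw [add_sub_sub_cancel, ← two_smul ℝ c, norm_smul, Real.norm_ofNat] at htri
  linarith

/-- In the coordinates `x = s + τ`, `y = s - τ` the points `(x, conj x)` are those with `s` real and
`τ` imaginary, so the identity theorem applies first in `s` and then in `τ`. -/
lemma mem_submodule_of_forall_conj_mem {F : ℂ × ℂ → E}
    (hF : DifferentiableOn ℂ F (ball 0 1 ×ˢ ball 0 1)) (hN : IsClosed (N : Set E))
    (h : ∀ x ∈ ball (0 : ℂ) 1, F (x, conj x) ∈ N) {x y : ℂ} (hx : x ∈ ball (0 : ℂ) 1)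
    (hy : y ∈ ball (0 : ℂ) 1) : F (x, y) ∈ N := by
  let U (c : ℂ) : Set ℂ := ball (-c) 1 ∩ ball c 1
  have mem_U {p c : ℂ} : p ∈ U c ↔ ‖p + c‖ < 1 ∧ ‖p - c‖ < 1 := by
    simp only [U, mem_inter_iff, mem_ball, dist_eq_norm, sub_neg_eq_add]
  have mem_U_comm {p c : ℂ} : p ∈ U c ↔ c ∈ U p := by
    rw [mem_U, mem_U, add_comm, norm_sub_rev]
  have zero_mem_U {p c : ℂ} (hp : p ∈ U c) : 0 ∈ U c := by
    have hc := norm_lt_one_of_norm_add_lt_one_of_norm_sub_lt_one (mem_U.1 hp).1 (mem_U.1 hp).2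
    simpa [mem_U] using hc
  have hUo (c : ℂ) : IsOpen (U c) := isOpen_ball.inter isOpen_ball
  have hUc (c : ℂ) : IsPreconnected (U c) :=
    ((convex_ball _ _).inter (convex_ball _ _)).isPreconnected
  have hFs (τ : ℂ) : DifferentiableOn ℂ (fun s => F (s + τ, s - τ)) (U τ) :=
    hF.comp (by fun_prop) fun s hs => by simpa using mem_U.1 hs
  have hFτ (s : ℂ) : DifferentiableOn ℂ (fun τ => F (s + τ, s - τ)) (U s) :=
    hF.comp (by fun_prop) fun τ hτ => by simpa using mem_U.1 (mem_U_comm.1 hτ)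
  have himag (t : ℝ) {s : ℂ} (hs : s ∈ U (t * Complex.I)) :
      F (s + t * Complex.I, s - t * Complex.I) ∈ N := by
    refine mem_submodule_of_forall_real_mul_mem (hFs _) (hUo _) (hUc _) hN (zero_mem_U hs)
      one_ne_zero (fun r hr => ?_) hs
    rw [mul_one] at hr ⊢
    simpa [← sub_eq_add_neg] using h (r + t * Complex.I) (by simpa using (mem_U.1 hr).1)
  have hall {s τ : ℂ} (hτ : τ ∈ U s) : F (s + τ, s - τ) ∈ N :=
    mem_submodule_of_forall_real_mul_mem (hFτ s) (hUo s) (hUc s) hN (zero_mem_U hτ)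
      Complex.I_ne_zero (fun t ht => himag t (mem_U_comm.1 ht)) hτ
  have hxy := @hall ((x + y) / 2) ((x - y) / 2)
  rw [mem_U_comm, mem_U, show (x + y) / 2 + (x - y) / 2 = x by ring,
    show (x + y) / 2 - (x - y) / 2 = y by ring] at hxy
  exact hxy ⟨mem_ball_zero_iff.1 hx, mem_ball_zero_iff.1 hy⟩

end Polarization

lemma isUnit_one_sub_smul {A : Type*} [NormedRing A] [NormedSpace ℂ A] [CompleteSpace A]
    {e : A} (he : ‖e‖ ≤ 1) {x : ℂ} (hx : ‖x‖ < 1) : IsUnit (1 - x • e) :=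
  isUnit_one_sub_of_norm_lt_one
    ((norm_smul x e).trans_lt (mul_lt_one_of_nonneg_of_lt_one_left (norm_nonneg x) hx he))

section

open BoundedContinuousFunction

/-- A bounded continuous function that is the identity on the unit disk. -/
def diskCoord : ℂ →ᵇ ℂ :=
  .ofNormedAddCommGroup (fun η => η / (max 1 ‖η‖ : ℝ))
    (by fun_prop (disch := intro η; exact_mod_cast (lt_max_of_lt_left one_pos).ne')) 1
    fun η => by
      rw [norm_div, Complex.norm_real, Real.norm_of_nonneg (by positivity)]
      exact div_le_one_of_le₀ (le_max_right _ _) (by positivity)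

lemma diskCoord_apply {η : ℂ} (hη : ‖η‖ ≤ 1) : diskCoord η = η := by
  change η / (max 1 ‖η‖ : ℝ) = η
  rw [max_eq_left hη, Complex.ofReal_one, div_one]

lemma norm_diskCoord_le : ‖diskCoord‖ ≤ 1 :=
  norm_ofNormedAddCommGroup_le _ zero_le_one _

lemma norm_star_diskCoord_le : ‖star diskCoord‖ ≤ 1 :=
  (norm_star diskCoord).trans_le norm_diskCoord_le

/-- The function `η ↦ (1 - xη)⁻² (1 - yη̄)⁻²` on the unit disk, as an element of a Banach algebra in
which it depends holomorphically on `x` and `y`. -/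
def kernelPair (p : ℂ × ℂ) : ℂ →ᵇ ℂ :=
  Ring.inverse (1 - p.1 • diskCoord) ^ 2 * Ring.inverse (1 - p.2 • star diskCoord) ^ 2

lemma differentiableOn_kernelPair : DifferentiableOn ℂ kernelPair (ball 0 1 ×ˢ ball 0 1) := by
  intro p hp
  have hx := isUnit_one_sub_smul norm_diskCoord_le (mem_ball_zero_iff.1 hp.1)
  have hy := isUnit_one_sub_smul norm_star_diskCoord_le (mem_ball_zero_iff.1 hp.2)
  unfold kernelPair
  refine DifferentiableAt.differentiableWithinAt ?_
  fun_prop (disch := assumption)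

lemma kernelPair_apply {x y η : ℂ} (hx : ‖x‖ < 1) (hy : ‖y‖ < 1) (hη : ‖η‖ ≤ 1) :
    kernelPair (conj x, y) η = kernelFun x η * conj (kernelFun y η) := by
  have inverse_apply {f : ℂ →ᵇ ℂ} (hf : IsUnit f) : Ring.inverse f η = (f η)⁻¹ :=
    eq_inv_of_mul_eq_one_right (DFunLike.congr_fun (Ring.mul_inverse_cancel f hf) η)
  have hx' := isUnit_one_sub_smul norm_diskCoord_le (x := conj x) (by simpa using hx)
  have hy' := isUnit_one_sub_smul norm_star_diskCoord_le hy
  rw [kernelPair, mul_apply, pow_apply, pow_apply, inverse_apply hx', inverse_apply hy']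
  simp [kernelFun, diskCoord_apply hη]

lemma exists_continuousLinearMap_eq_integral_mul {X : Type*} [TopologicalSpace X]
    [MeasurableSpace X] [OpensMeasurableSpace X] (μ : Measure X) [IsProbabilityMeasure μ]
    {f : X → ℂ} (hf : AEStronglyMeasurable f μ) {M : ℝ} (hM : ∀ x, ‖f x‖ ≤ M) :
    ∃ Λ : (X →ᵇ ℂ) →L[ℂ] ℂ, ‖Λ‖ ≤ M ∧ ∀ ψ, Λ ψ = ∫ x, f x * ψ x ∂μ := by
  obtain ⟨x₀⟩ := μ.nonempty_of_neZero
  have hM₀ : 0 ≤ M := (norm_nonneg _).trans (hM x₀)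
  have hint (ψ : X →ᵇ ℂ) : Integrable (fun x => f x * ψ x) μ :=
    (ψ.integrable μ).bdd_mul hf (ae_of_all _ hM)
  let Λ : (X →ᵇ ℂ) →ₗ[ℂ] ℂ :=
    { toFun := fun ψ => ∫ x, f x * ψ x ∂μ
      map_add' := fun ψ φ => by
        simp_rw [coe_add, Pi.add_apply, mul_add]
        exact integral_add (hint ψ) (hint φ)
      map_smul' := fun c ψ => by
        simp_rw [coe_smul, smul_eq_mul, mul_left_comm _ c, integral_const_mul, RingHom.id_apply] }
  have hΛ (ψ : X →ᵇ ℂ) : ‖Λ ψ‖ ≤ M * ‖ψ‖ := by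
    have hbound (x : X) : ‖f x * ψ x‖ ≤ M * ‖ψ‖ := by
      rw [norm_mul]
      exact mul_le_mul (hM x) (ψ.norm_coe_le_norm x) (norm_nonneg _) hM₀
    change ‖∫ x, f x * ψ x ∂μ‖ ≤ _
    simpa using norm_integral_le_of_norm_le_const (ae_of_all μ hbound)
  exact ⟨Λ.mkContinuous M hΛ, Λ.mkContinuous_norm_le hM₀ hΛ, fun _ => rfl⟩

lemma tendsto_toeplitzKernel_self_comp_moebius {v : ℂ → ℂ}
    (hB : Tendsto (fun z : 𝔻 => berezinTransform v z) toBoundary (𝓝 0)) {a : ℂ} (ha : ‖a‖ < 1) :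
    Tendsto (fun z : 𝔻 => toeplitzKernel (v ∘ moebius z) a a) toBoundary (𝓝 0) := by
  lift a to 𝔻 using ha
  have hlim := (hB.comp (tendsto_moebiusDisc a)).const_mul ((1 - (‖(a : ℂ)‖ : ℂ) ^ 2) ^ 2)⁻¹
  rw [mul_zero] at hlim
  refine hlim.congr fun z => ?_
  rw [Function.comp_apply, coe_moebiusDisc, berezinTransform_moebius v z.norm_lt_one a.norm_lt_one,
    berezinTransform, inv_mul_cancel_left₀]
  exact pow_ne_zero _ (one_sub_norm_sq_ne_zero a.norm_lt_one)

lemma tendsto_toeplitzKernel_comp_moebius {v : ℂ → ℂ} (hv : Measurable v) {M : ℝ}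
    (hM : ∀ w, ‖v w‖ ≤ M)
    (hB : Tendsto (fun z : 𝔻 => berezinTransform v z) toBoundary (𝓝 0)) {a b : ℂ}
    (ha : ‖a‖ < 1) (hb : ‖b‖ < 1) :
    Tendsto (fun z : 𝔻 => toeplitzKernel (v ∘ moebius z) a b) toBoundary (𝓝 0) := by
  choose Λ hΛM hΛ using fun z : 𝔻 => exists_continuousLinearMap_eq_integral_mul diskMeasure
    (hv.comp (measurable_moebius z)).aestronglyMeasurable fun w => hM (moebius z w)
  have hΛ_kernelPair {x y : ℂ} (hx : ‖x‖ < 1) (hy : ‖y‖ < 1) (z : 𝔻) :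
      Λ z (kernelPair (conj x, y)) = toeplitzKernel (v ∘ moebius z) y x := by
    rw [hΛ, toeplitzKernel]
    refine integral_congr_ae ?_
    filter_upwards [ae_norm_lt_one] with η hη
    rw [kernelPair_apply hx hy hη.le]
  have hdiag (x : ℂ) (hx : x ∈ ball 0 1) :
      kernelPair (x, conj x) ∈ vanishingSubmodule Λ toBoundary := by
    have hx' : ‖conj x‖ < 1 := by simpa using hx
    refine mem_vanishingSubmodule.2
      ((tendsto_toeplitzKernel_self_comp_moebius hB hx').congr fun z => ?_)
    rw [← hΛ_kernelPair hx' hx', Complex.conj_conj]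
  have hmem := mem_submodule_of_forall_conj_mem differentiableOn_kernelPair
    (isClosed_vanishingSubmodule hΛM toBoundary) hdiag (x := conj b) (y := a)
    (by simpa using hb) (mem_ball_zero_iff.2 ha)
  exact (mem_vanishingSubmodule.1 hmem).congr (hΛ_kernelPair hb ha)

end

/-! ### Forelli–Rudin estimates -/

lemma lintegral_diskMeasure_le_of_polar {f : ℂ → ℝ≥0∞} {A B : ℝ → ℝ≥0∞} (hA : Measurable A)
    (hB : Measurable B) (hf : ∀ r ∈ Ioo (0 : ℝ) 1, ∀ θ ∈ Ioo (-Real.pi) Real.pi, θ ≠ 0 →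
      f (r * (Real.cos θ + Real.sin θ * Complex.I)) ≤ A r * B θ) :
    ∫⁻ w, f w ∂diskMeasure ≤ (volume (ball (0 : ℂ) 1))⁻¹ *
      ((∫⁻ r in Ioo (0 : ℝ) 1, A r) * ∫⁻ θ in Ioo (-Real.pi) Real.pi, B θ) := by
  have hne : ∀ᵐ p : ℝ × ℝ, p.2 ≠ 0 :=
    Measure.quasiMeasurePreserving_snd.ae (Measure.ae_ne volume (0 : ℝ))
  have hA' : Measurable ((Ioo (0 : ℝ) 1).indicator A) := hA.indicator measurableSet_Ioo
  rw [lintegral_diskMeasure, ← lintegral_indicator isOpen_ball.measurableSet,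
    ← Complex.lintegral_comp_polarCoord_symm]
  gcongr
  calc ∫⁻ p in polarCoord.target,
        ENNReal.ofReal p.1 • (ball 0 1).indicator f (Complex.polarCoord.symm p)
      ≤ ∫⁻ p in polarCoord.target, (Ioo (0 : ℝ) 1).indicator A p.1 * B p.2 := by
        refine setLIntegral_mono_ae (by fun_prop) ?_
        filter_upwards [hne] with p hp₀ ⟨hr, hθ⟩
        rw [mem_Ioi] at hr
        have hnorm : ‖Complex.polarCoord.symm p‖ = p.1 := by
          rw [Complex.norm_polarCoord_symm, abs_of_pos hr]
        by_cases hr₁ : p.1 < 1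
        · rw [indicator_of_mem (mem_ball_zero_iff.2 (hnorm ▸ hr₁)),
            indicator_of_mem (mem_Ioo.2 ⟨hr, hr₁⟩), Complex.polarCoord_symm_apply]
          exact (mul_le_of_le_one_left' (ENNReal.ofReal_le_one.2 hr₁.le)).trans
            (hf p.1 ⟨hr, hr₁⟩ p.2 hθ hp₀)
        · rw [indicator_of_notMem (by rwa [mem_ball_zero_iff, hnorm]), smul_zero]
          exact zero_le
    _ = (∫⁻ r in Ioi 0, (Ioo (0 : ℝ) 1).indicator A r) *
          ∫⁻ θ in Ioo (-Real.pi) Real.pi, B θ := by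
        rw [polarCoord_target, Measure.volume_eq_prod, ← Measure.prod_restrict,
          lintegral_prod_mul hA'.aemeasurable hB.aemeasurable]
    _ ≤ (∫⁻ r in Ioo (0 : ℝ) 1, A r) * ∫⁻ θ in Ioo (-Real.pi) Real.pi, B θ := by
        rw [← lintegral_indicator measurableSet_Ioo A]
        gcongr
        exact Measure.restrict_le_self

lemma abs_div_two_pi_le_norm_one_sub {ρ θ : ℝ} (hρ₀ : 0 ≤ ρ) (hρ : ρ ≤ 1) (hθ : |θ| ≤ Real.pi) :
    |θ| / (2 * Real.pi) ≤ ‖(1 : ℂ) - ρ * (Real.cos θ + Real.sin θ * Complex.I)‖ := by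
  have hcos := Real.cos_le_one_sub_mul_cos_sq hθ
  have hnorm : ‖(1 : ℂ) - ρ * (Real.cos θ + Real.sin θ * Complex.I)‖ ^ 2 =
      (1 - ρ) ^ 2 + 2 * ρ * (1 - Real.cos θ) := by
    rw [← Complex.normSq_eq_norm_sq, Complex.normSq_apply]
    simp only [Complex.sub_re, Complex.one_re, Complex.mul_re, Complex.ofReal_re, Complex.add_re,
      Complex.I_re, Complex.ofReal_im, Complex.I_im, Complex.add_im, Complex.mul_im,
      Complex.sub_im, Complex.one_im]
    nlinarith [Real.sin_sq_add_cos_sq θ]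
  have hsq : (|θ| / (2 * Real.pi)) ^ 2 = (2 / Real.pi ^ 2 * θ ^ 2) / 8 := by
    rw [div_pow, sq_abs]
    field_simp
    norm_num
  refine (sq_le_sq₀ (by positivity) (norm_nonneg _)).1 ?_
  rw [hnorm, hsq]
  rcases le_total ρ (1 / 2) with h | h <;>
    nlinarith [sq_nonneg (1 - ρ), Real.neg_one_le_cos θ, Real.cos_le_one θ]

lemma lintegral_one_sub_rpow_lt_top {γ : ℝ} (hγ : γ < 1) :
    ∫⁻ r in Ioo (0 : ℝ) 1, ENNReal.ofReal ((1 - r) ^ (-γ)) < ∞ := by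
  have hint := (intervalIntegral.intervalIntegrable_rpow' (a := 0) (b := 1)
    (neg_lt_neg hγ)).comp_sub_left 1
  simp only [sub_zero, sub_self] at hint
  exact ((intervalIntegrable_iff_integrableOn_Ioo_of_le zero_le_one).1 hint.symm).lintegral_lt_top

lemma lintegral_abs_div_rpow_lt_top {γ : ℝ} (hγ : γ < 1) :
    ∫⁻ θ in Ioo (-Real.pi) Real.pi, ENNReal.ofReal ((|θ| / (2 * Real.pi)) ^ (-γ)) < ∞ := by
  have hright : IntervalIntegrable (fun θ : ℝ => (|θ| / (2 * Real.pi)) ^ (-γ)) volume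
      0 Real.pi := by
    refine ((intervalIntegral.intervalIntegrable_rpow' (a := 0) (b := Real.pi)
      (neg_lt_neg hγ)).div_const ((2 * Real.pi) ^ (-γ))).congr fun θ hθ => ?_
    rw [uIoc_of_le Real.pi_pos.le] at hθ
    simp only [abs_of_pos hθ.1, Real.div_rpow hθ.1.le Real.two_pi_pos.le]
  have hleft : IntervalIntegrable (fun θ : ℝ => (|θ| / (2 * Real.pi)) ^ (-γ)) volume
      (-Real.pi) 0 := by
    simpa using ((IntervalIntegrable.iff_comp_neg (by simp)).1 hright).symm
  exact ((intervalIntegrable_iff_integrableOn_Ioo_of_le (by linarith [Real.pi_pos])).1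
    (hleft.trans hright)).lintegral_lt_top

lemma exists_norm_eq_one_conj_mul (z : ℂ) : ∃ c : ℂ, ‖c‖ = 1 ∧ conj z * c = ‖z‖ := by
  rcases eq_or_ne z 0 with rfl | hz
  · exact ⟨1, by simp, by simp⟩
  · have hz' : (‖z‖ : ℂ) ≠ 0 := by simpa using hz
    refine ⟨z / ‖z‖, by simp [hz], ?_⟩
    rw [← mul_div_assoc, Complex.conj_mul', sq, mul_div_assoc, div_self hz', mul_one]

lemma exists_lintegral_norm_one_sub_conj_mul_rpow_le_of_lt_one {γ : ℝ} (hγ₀ : 0 ≤ γ) (hγ : γ < 1) :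
    ∃ C : ℝ≥0, ∀ z : ℂ, ‖z‖ < 1 →
      ∫⁻ a, ENNReal.ofReal (‖1 - conj z * a‖ ^ (-γ) * (1 - ‖a‖) ^ (-γ)) ∂diskMeasure ≤ C := by
  have hfin : (volume (ball (0 : ℂ) 1))⁻¹ *
      ((∫⁻ r in Ioo (0 : ℝ) 1, ENNReal.ofReal ((1 - r) ^ (-γ))) *
        ∫⁻ θ in Ioo (-Real.pi) Real.pi, ENNReal.ofReal ((|θ| / (2 * Real.pi)) ^ (-γ))) ≠ ∞ :=
    ENNReal.mul_ne_top (ENNReal.inv_ne_top.2 (measure_ball_pos volume _ one_pos).ne')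
      (ENNReal.mul_ne_top (lintegral_one_sub_rpow_lt_top hγ).ne
        (lintegral_abs_div_rpow_lt_top hγ).ne)
  obtain ⟨C, hC⟩ : ∃ C : ℝ≥0, (C : ℝ≥0∞) = _ := WithTop.ne_top_iff_exists.1 hfin
  refine ⟨C, fun z hz => ?_⟩
  obtain ⟨c, hc, hcz⟩ := exists_norm_eq_one_conj_mul z
  rw [← (measurePreserving_mul_diskMeasure hc).lintegral_comp (by fun_prop)]
  simp only [← mul_assoc, hcz, norm_mul, hc, one_mul]
  rw [hC]
  refine lintegral_diskMeasure_le_of_polar (by fun_prop) (by fun_prop) fun r hr θ hθ hθ₀ => ?_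
  have hnorm : ‖(r : ℂ) * (Real.cos θ + Real.sin θ * Complex.I)‖ = r := by
    rw [← Complex.polarCoord_symm_apply (r, θ), Complex.norm_polarCoord_symm, abs_of_pos hr.1]
  have hpos : 0 ≤ 1 - r := by linarith [hr.2]
  have hlow := abs_div_two_pi_le_norm_one_sub (ρ := ‖z‖ * r) (θ := θ)
    (mul_nonneg (norm_nonneg z) hr.1.le) (mul_le_one₀ hz.le hr.1.le hr.2.le)
    (abs_le.2 ⟨hθ.1.le, hθ.2.le⟩)
  rw [Complex.ofReal_mul, mul_assoc] at hlow
  rw [hnorm, ← ENNReal.ofReal_mul (by positivity), mul_comm]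
  gcongr ENNReal.ofReal (_ * ?_)
  exact Real.rpow_le_rpow_of_nonpos (by positivity) hlow (neg_nonpos.2 hγ₀)

lemma exists_lintegral_norm_one_sub_conj_mul_rpow_le {α β : ℝ} (hβα : β ≤ α) (hαβ₀ : 0 ≤ α + β)
    (hαβ : α + β < 2) : ∃ C : ℝ≥0, ∀ z : ℂ, ‖z‖ < 1 →
      ∫⁻ a, ENNReal.ofReal (‖1 - conj z * a‖ ^ (-α) * (1 - ‖a‖) ^ (-β)) ∂diskMeasure ≤ C := by
  obtain ⟨C, hC⟩ := exists_lintegral_norm_one_sub_conj_mul_rpow_le_of_lt_one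
    (γ := (α + β) / 2) (by linarith) (by linarith)
  refine ⟨C, fun z hz => (lintegral_mono_ae ?_).trans (hC z hz)⟩
  filter_upwards [ae_norm_lt_one] with a ha
  refine ENNReal.ofReal_le_ofReal ?_
  have hlow := one_sub_norm_right_le_norm_one_sub_conj_mul (b := a) hz.le
  have ha₀ : 0 < 1 - ‖a‖ := by linarith
  set X := ‖1 - conj z * a‖
  have hX : 0 < X := by linarith
  calc X ^ (-α) * (1 - ‖a‖) ^ (-β)
      = X ^ (-((α + β) / 2)) * (X ^ (-((α - β) / 2)) * (1 - ‖a‖) ^ (-β)) := by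
        rw [← mul_assoc, ← Real.rpow_add hX]
        ring_nf
    _ ≤ X ^ (-((α + β) / 2)) * ((1 - ‖a‖) ^ (-((α - β) / 2)) * (1 - ‖a‖) ^ (-β)) := by
        gcongr ?_ * (?_ * ?_)
        exact Real.rpow_le_rpow_of_nonpos ha₀ hlow (by linarith)
    _ = X ^ (-((α + β) / 2)) * (1 - ‖a‖) ^ (-((α + β) / 2)) := by
        rw [← Real.rpow_add ha₀]
        ring_nf

lemma norm_kernelFun_le_rpow {a b : ℂ} (ha : ‖a‖ < 1) (hb : ‖b‖ < 1) {s : ℝ} (hs : 0 ≤ s) :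
    ‖kernelFun a b‖ ≤ (1 - ‖a‖) ^ (-s) * ‖1 - conj a * b‖ ^ (-(2 - s)) := by
  have hlow := one_sub_norm_left_le_norm_one_sub_conj_mul (a := a) hb.le
  have ha₀ : 0 < 1 - ‖a‖ := by linarith
  have hX : 0 < ‖1 - conj a * b‖ := by linarith
  calc ‖kernelFun a b‖ = ‖1 - conj a * b‖ ^ (-s) * ‖1 - conj a * b‖ ^ (-(2 - s)) := by
        rw [norm_kernelFun, ← Real.rpow_add hX, ← Real.rpow_natCast, ← Real.rpow_neg hX.le]
        ring_nf
    _ ≤ _ := by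
        gcongr ?_ * _
        exact Real.rpow_le_rpow_of_nonpos ha₀ hlow (neg_nonpos.2 hs)

lemma exists_norm_toeplitzKernel_zero_le {s : ℝ} (hs₀ : 0 < s) (hs : s ≤ 2) :
    ∃ C : ℝ≥0, ∀ (v : ℂ → ℂ) (M : ℝ), (∀ w, ‖v w‖ ≤ M) → ∀ a : ℂ, ‖a‖ < 1 →
      ‖toeplitzKernel v a 0‖ ≤ M * C * (1 - ‖a‖) ^ (-s) := by
  obtain ⟨C, hC⟩ := exists_lintegral_norm_one_sub_conj_mul_rpow_le (α := 2 - s) (β := 0)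
    (by linarith) (by linarith) (by linarith)
  simp only [neg_zero, Real.rpow_zero, mul_one] at hC
  refine ⟨C, fun v M hM a ha => ?_⟩
  have hM₀ : 0 ≤ M := (norm_nonneg _).trans (hM 0)
  rw [← ENNReal.ofReal_le_ofReal_iff (by positivity), ofReal_norm]
  calc ‖toeplitzKernel v a 0‖ₑ
      ≤ ∫⁻ η, ‖v η * (kernelFun 0 η * conj (kernelFun a η))‖ₑ ∂diskMeasure :=
        enorm_integral_le_lintegral_enorm _
    _ ≤ ∫⁻ η, ENNReal.ofReal (M * (1 - ‖a‖) ^ (-s)) *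
          ENNReal.ofReal (‖1 - conj a * η‖ ^ (-(2 - s))) ∂diskMeasure := by
        refine lintegral_mono_ae ?_
        filter_upwards [ae_norm_lt_one] with η hη
        rw [← ENNReal.ofReal_mul (by positivity), ← ofReal_norm, norm_mul, kernelFun_zero_left,
          one_mul, RCLike.norm_conj, mul_assoc M]
        exact ENNReal.ofReal_le_ofReal (mul_le_mul (hM η) (norm_kernelFun_le_rpow ha hη hs₀.le)
          (norm_nonneg _) hM₀)
    _ = ENNReal.ofReal (M * (1 - ‖a‖) ^ (-s)) *
          ∫⁻ η, ENNReal.ofReal (‖1 - conj a * η‖ ^ (-(2 - s))) ∂diskMeasure :=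
        lintegral_const_mul _ (by fun_prop)
    _ ≤ ENNReal.ofReal (M * (1 - ‖a‖) ^ (-s)) * C := by
        gcongr
        exact hC a ha
    _ = ENNReal.ofReal (M * C * (1 - ‖a‖) ^ (-s)) := by
        rw [← ENNReal.ofReal_coe_nnreal, ← ENNReal.ofReal_mul (by positivity), mul_right_comm]

lemma memLp_one_sub_norm_rpow {s : ℝ} {p : ℝ≥0∞} (hs : 0 ≤ s) (hp₀ : p ≠ 0) (hp : p ≠ ∞)
    (hsp : s * p.toReal < 1) : MemLp (fun a : ℂ => (1 - ‖a‖) ^ (-s)) p diskMeasure := by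
  have hsp₀ : 0 ≤ s * p.toReal := mul_nonneg hs ENNReal.toReal_nonneg
  obtain ⟨C, hC⟩ := exists_lintegral_norm_one_sub_conj_mul_rpow_le (α := s * p.toReal)
    (β := s * p.toReal) le_rfl (by linarith) (by linarith)
  refine ⟨Measurable.aestronglyMeasurable (by fun_prop),
    (eLpNorm_lt_top_iff_lintegral_rpow_enorm_lt_top hp₀ hp).2 ?_⟩
  refine (lintegral_mono_ae ?_).trans_lt ((hC 0 (by simp)).trans_lt ENNReal.coe_lt_top)
  filter_upwards [ae_norm_lt_one] with a ha
  have ha₀ : 0 < 1 - ‖a‖ := by linarith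
  rw [← ofReal_norm, Real.norm_of_nonneg (by positivity),
    ENNReal.ofReal_rpow_of_nonneg (by positivity) ENNReal.toReal_nonneg, ← Real.rpow_mul ha₀.le,
    neg_mul]
  simp

/-! ### Weighted estimates for the integral kernel of a Toeplitz operator -/

lemma measurable_toeplitzKernel {v : ℂ → ℂ} (hv : Measurable v) :
    Measurable (Function.uncurry (toeplitzKernel v)) := by
  have hconj : Measurable (conj : ℂ → ℂ) := Complex.continuous_conj.measurable
  have hmeas : Measurable fun q : (ℂ × ℂ) × ℂ =>
      v q.2 * (kernelFun q.1.2 q.2 * conj (kernelFun q.1.1 q.2)) := by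
    unfold kernelFun
    fun_prop
  exact hmeas.stronglyMeasurable.integral_prod_right'.measurable

lemma measurable_toeplitzKernel_left {v : ℂ → ℂ} (hv : Measurable v) (z : ℂ) :
    Measurable fun w : ℂ => toeplitzKernel v w z :=
  (measurable_toeplitzKernel hv).of_uncurry_right

lemma toeplitzKernel_conj (v : ℂ → ℂ) (w z : ℂ) :
    toeplitzKernel (fun ζ => conj (v ζ)) z w = conj (toeplitzKernel v w z) := by
  rw [toeplitzKernel, toeplitzKernel, ← integral_conj]
  congr 1 with ζ
  simp only [map_mul, Complex.conj_conj, mul_comm (kernelFun w ζ)]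

/-- The weight `(1 - |w|²)^(-1/2)` for the Schur test. -/
def schurWeight (w : ℂ) : ℝ≥0∞ := ENNReal.ofReal (√(1 - ‖w‖ ^ 2))⁻¹

lemma measurable_schurWeight : Measurable schurWeight := by unfold schurWeight; fun_prop

lemma schurWeight_ne_top (w : ℂ) : schurWeight w ≠ ∞ := ENNReal.ofReal_ne_top

lemma schurWeight_ne_zero {w : ℂ} (hw : ‖w‖ < 1) : schurWeight w ≠ 0 := by
  have hpos := one_sub_norm_sq_pos hw
  exact (ENNReal.ofReal_pos.2 (by positivity)).ne'

lemma moebiusJac_mul_enorm_toeplitzKernel_mul_schurWeight (v : ℂ → ℂ) {z a : ℂ} (hz : ‖z‖ < 1)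
    (ha : ‖a‖ < 1) :
    ENNReal.ofReal (moebiusJac z a) *
        (‖toeplitzKernel v (moebius z a) z‖ₑ * schurWeight (moebius z a)) =
      schurWeight z * (‖toeplitzKernel (v ∘ moebius z) a 0‖ₑ *
        ENNReal.ofReal (‖1 - conj z * a‖⁻¹ * (√(1 - ‖a‖ ^ 2))⁻¹)) := by
  have hkernel := toeplitzKernel_moebius v (b := 0) hz ha (by simp)
  rw [moebius_zero_right, map_zero, mul_zero, sub_zero, mul_one] at hkernel
  have hz₀ := one_sub_norm_sq_pos hz
  have ha₀ := one_sub_norm_sq_pos ha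
  have hX : 0 < ‖1 - conj z * a‖ := norm_pos_iff.2 (one_sub_conj_mul_ne_zero hz ha)
  rw [hkernel, schurWeight, schurWeight, one_sub_norm_moebius_sq hz ha, moebiusJac,
    ← ofReal_norm, ← ofReal_norm (toeplitzKernel _ _ _), norm_mul, norm_div, norm_pow, norm_pow,
    norm_one_sub_norm_sq hz, Real.sqrt_div (by positivity), Real.sqrt_mul hz₀.le,
    Real.sqrt_sq hX.le]
  rw [← ENNReal.ofReal_mul (by positivity), ← ENNReal.ofReal_mul (by positivity),
    ← ENNReal.ofReal_mul (by positivity), ← ENNReal.ofReal_mul (by positivity)]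
  congr 1
  field_simp

lemma exists_lintegral_inv_norm_one_sub_conj_mul_rpow_le {q : ℝ} (hq₀ : 0 ≤ q) (hq : q < 4 / 3) :
    ∃ C : ℝ≥0, ∀ z : ℂ, ‖z‖ < 1 →
      ∫⁻ a, ENNReal.ofReal (‖1 - conj z * a‖⁻¹ * (√(1 - ‖a‖ ^ 2))⁻¹) ^ q ∂diskMeasure ≤ C := by
  obtain ⟨C, hC⟩ := exists_lintegral_norm_one_sub_conj_mul_rpow_le (α := q) (β := q / 2)
    (by linarith) (by linarith) (by linarith)
  refine ⟨C, fun z hz => (lintegral_mono_ae ?_).trans (hC z hz)⟩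
  filter_upwards [ae_norm_lt_one] with a ha
  have ha₀ : 0 < 1 - ‖a‖ := by linarith
  have hle : 1 - ‖a‖ ≤ 1 - ‖a‖ ^ 2 := by nlinarith [norm_nonneg a]
  have hsqrt : (√(1 - ‖a‖ ^ 2))⁻¹ ^ q = (1 - ‖a‖ ^ 2) ^ (-(q / 2)) := by
    rw [Real.sqrt_eq_rpow, ← Real.rpow_neg (by linarith), ← Real.rpow_mul (by linarith)]
    ring_nf
  rw [ENNReal.ofReal_rpow_of_nonneg (by positivity) hq₀,
    Real.mul_rpow (by positivity) (by positivity), hsqrt, Real.inv_rpow (norm_nonneg _),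
    ← Real.rpow_neg (norm_nonneg _)]
  gcongr ENNReal.ofReal (_ * ?_)
  exact Real.rpow_le_rpow_of_nonpos ha₀ hle (by linarith)

/- The exponent `6` could be the conjugate of any exponent in `(1, 4 / 3)`. -/
lemma exists_lintegral_toeplitzKernel_mul_schurWeight_le : ∃ C : ℝ≥0, ∀ v : ℂ → ℂ,
    Measurable v → ∀ z : ℂ, ‖z‖ < 1 →
      ∫⁻ w, ‖toeplitzKernel v w z‖ₑ * schurWeight w ∂diskMeasure ≤
        C * eLpNorm (fun a => toeplitzKernel (v ∘ moebius z) a 0) 6 diskMeasure *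
          schurWeight z := by
  obtain ⟨C, hC⟩ := exists_lintegral_inv_norm_one_sub_conj_mul_rpow_le (q := 6 / 5)
    (by norm_num) (by norm_num)
  refine ⟨C ^ (5 / 6 : ℝ), fun v hv z hz => ?_⟩
  have hmeas := measurable_toeplitzKernel_left (hv.comp (measurable_moebius z)) 0
  have hpq : (6 : ℝ).HolderConjugate (6 / 5) := by
    rw [Real.holderConjugate_iff]
    norm_num
  rw [lintegral_eq_lintegral_moebius hz, lintegral_congr_ae (ae_norm_lt_one.mono fun a ha =>
    moebiusJac_mul_enorm_toeplitzKernel_mul_schurWeight v hz ha),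
    lintegral_const_mul' _ _ (schurWeight_ne_top z), mul_comm]
  gcongr
  refine (ENNReal.lintegral_mul_le_Lp_mul_Lq diskMeasure hpq hmeas.enorm.aemeasurable
    (by fun_prop)).trans ?_
  rw [mul_comm, eLpNorm_eq_lintegral_rpow_enorm_toReal (by norm_num) (by norm_num),
    ENNReal.coe_rpow_of_nonneg _ (by norm_num), ENNReal.toReal_ofNat, one_div_div]
  gcongr
  exact hC z hz

lemma exists_eLpNorm_toeplitzKernel_zero_le : ∃ D : ℝ≥0, ∀ (v : ℂ → ℂ) (M : ℝ),
    (∀ w, ‖v w‖ ≤ M) →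
      eLpNorm (fun a => toeplitzKernel v a 0) 6 diskMeasure ≤ ENNReal.ofReal M * D := by
  obtain ⟨C, hC⟩ := exists_norm_toeplitzKernel_zero_le (s := 1 / 10) (by norm_num) (by norm_num)
  have hmem : MemLp (fun a : ℂ => C * (1 - ‖a‖) ^ (-(1 / 10) : ℝ)) 6 diskMeasure :=
    (memLp_one_sub_norm_rpow (by norm_num) (by norm_num) (by norm_num) (by norm_num)).const_mul _
  refine ⟨(eLpNorm (fun a : ℂ => C * (1 - ‖a‖) ^ (-(1 / 10) : ℝ)) 6 diskMeasure).toNNReal,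
    fun v M hM => ?_⟩
  rw [ENNReal.coe_toNNReal hmem.eLpNorm_ne_top]
  refine eLpNorm_le_mul_eLpNorm_of_ae_le_mul ?_ 6
  filter_upwards [ae_norm_lt_one] with a ha
  rw [Real.norm_of_nonneg (by positivity), ← mul_assoc]
  exact hC v M hM a ha

lemma tendsto_eLpNorm_toeplitzKernel_comp_moebius {v : ℂ → ℂ} (hv : Measurable v) {M : ℝ}
    (hM : ∀ w, ‖v w‖ ≤ M)
    (hB : Tendsto (fun z : 𝔻 => berezinTransform v z) toBoundary (𝓝 0)) :
    Tendsto (fun z : 𝔻 => eLpNorm (fun a => toeplitzKernel (v ∘ moebius z) a 0) 6 diskMeasure)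
      toBoundary (𝓝 0) := by
  obtain ⟨C, hC⟩ := exists_norm_toeplitzKernel_zero_le (s := 1 / 10) (by norm_num) (by norm_num)
  refine tendsto_eLpNorm_zero_of_dominated (g := fun a => M * C * (1 - ‖a‖) ^ (-(1 / 10) : ℝ))
    (by norm_num) (by norm_num) (fun z => (measurable_toeplitzKernel_left
      (hv.comp (measurable_moebius z)) 0).stronglyMeasurable) ?_ (fun z => ?_) ?_
  · exact (memLp_one_sub_norm_rpow (by norm_num) (by norm_num) (by norm_num)
      (by norm_num)).const_mul _
  · exact ae_norm_lt_one.mono fun a ha => hC _ M (fun w => hM _) a ha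
  · exact ae_norm_lt_one.mono fun a ha =>
      tendsto_toeplitzKernel_comp_moebius hv hM hB ha (by simp)

lemma exists_lintegral_toeplitzKernel_right_le {v : ℂ → ℂ} (hv : Measurable v) {M : ℝ}
    (hM : ∀ w, ‖v w‖ ≤ M) : ∃ C : ℝ≥0, ∀ w : ℂ, ‖w‖ < 1 →
      ∫⁻ z, ‖toeplitzKernel v w z‖ₑ * schurWeight z ∂diskMeasure ≤ C * schurWeight w := by
  obtain ⟨C, hC⟩ := exists_lintegral_toeplitzKernel_mul_schurWeight_le
  obtain ⟨D, hD⟩ := exists_eLpNorm_toeplitzKernel_zero_le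
  refine ⟨C * (M.toNNReal * D), fun w hw => ?_⟩
  have hconj := hC (fun ζ => conj (v ζ)) (Complex.continuous_conj.measurable.comp hv) w hw
  simp only [toeplitzKernel_conj, RCLike.enorm_conj] at hconj
  refine hconj.trans ?_
  push_cast
  gcongr
  exact hD _ M fun ζ => (RCLike.norm_conj _).trans_le (hM _)

/-! ### Cutting off near the boundary -/

/-- The indicator function of the closed disk of radius `r`, as a symbol. -/
def closedBallIndicator (r : ℝ) : Lp ℂ ∞ diskMeasure :=
  indicatorConstLp ∞ measurableSet_closedBall (measure_ne_top diskMeasure (closedBall 0 r)) 1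

lemma closedBallIndicator_ae_eq (r : ℝ) :
    closedBallIndicator r =ᵐ[diskMeasure] (closedBall 0 r).indicator fun _ => 1 :=
  indicatorConstLp_coeFn

/-- The Toeplitz operator whose symbol is the indicator function of the closed disk of radius `r`.
Precomposing `T_u` with it leaves out of the integral representation of `T_u` the part near the
boundary, up to an operator that the Schur test controls. -/
def cutoff (r : ℝ) : bergmanSpace →L[ℂ] bergmanSpace :=
  toeplitz (closedBallIndicator r)

lemma inner_cutoff (r : ℝ) (f g : bergmanSpace) :
    inner ℂ f (cutoff r g) = ∫ z in closedBall 0 r,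
      (g : Lp ℂ 2 diskMeasure) z * conj ((f : Lp ℂ 2 diskMeasure) z) ∂diskMeasure := by
  rw [cutoff, inner_toeplitz, ← integral_indicator measurableSet_closedBall]
  refine integral_congr_ae ?_
  filter_upwards [closedBallIndicator_ae_eq r] with z hz
  rw [hz]
  by_cases hzr : z ∈ closedBall 0 r <;> simp [hzr]

lemma inner_sub_cutoff (r : ℝ) (f g : bergmanSpace) :
    inner ℂ f (g - cutoff r g) = ∫ z in (closedBall 0 r)ᶜ,
      (g : Lp ℂ 2 diskMeasure) z * conj ((f : Lp ℂ 2 diskMeasure) z) ∂diskMeasure := by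
  have hint : Integrable (fun z => (g : Lp ℂ 2 diskMeasure) z *
      conj ((f : Lp ℂ 2 diskMeasure) z)) diskMeasure := by
    simpa only [RCLike.inner_apply] using
      L2.integrable_inner (𝕜 := ℂ) (f : Lp ℂ 2 diskMeasure) (g : Lp ℂ 2 diskMeasure)
  rw [inner_sub_right, inner_cutoff, setIntegral_compl measurableSet_closedBall hint,
    Submodule.coe_inner, L2.inner_def]
  simp only [RCLike.inner_apply]

lemma bergmanSpace.ae_eq_of_forall_apply_eq {f : bergmanSpace} {g : ℂ → ℂ}
    (h : ∀ z : 𝔻, f z = g z) : (f : Lp ℂ 2 diskMeasure) =ᵐ[diskMeasure] g := by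
  filter_upwards [coe_ae_eq_rep f, ae_norm_lt_one] with z hf hz
  lift z to 𝔻 using hz
  rw [hf, ← h z, apply_eq (differentiableOn_rep f) (coe_ae_eq_rep f)]

lemma adjoint_toeplitz_bergmanKernel_ae_eq {u : Lp ℂ ∞ diskMeasure} {v : ℂ → ℂ}
    (huv : u =ᵐ[diskMeasure] v) (w : 𝔻) :
    ((toeplitz u).adjoint (bergmanKernel w) : Lp ℂ 2 diskMeasure) =ᵐ[diskMeasure]
      fun z => conj (toeplitzKernel v w z) := by
  refine bergmanSpace.ae_eq_of_forall_apply_eq fun z => ?_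
  rw [← inner_bergmanKernel, ContinuousLinearMap.adjoint_inner_right, ← inner_conj_symm,
    inner_bergmanKernel, toeplitz_bergmanKernel_apply huv]

lemma toeplitz_sub_cutoff_apply {u : Lp ℂ ∞ diskMeasure} {v : ℂ → ℂ}
    (huv : u =ᵐ[diskMeasure] v) (r : ℝ) (f : bergmanSpace) (w : 𝔻) :
    toeplitz u (f - cutoff r f) w = ∫ z in (closedBall 0 r)ᶜ,
      toeplitzKernel v w z * (f : Lp ℂ 2 diskMeasure) z ∂diskMeasure := by
  rw [← inner_bergmanKernel, ← ContinuousLinearMap.adjoint_inner_left, inner_sub_cutoff]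
  refine integral_congr_ae (ae_restrict_of_ae ?_)
  filter_upwards [adjoint_toeplitz_bergmanKernel_ae_eq huv w] with z hz
  rw [hz, Complex.conj_conj, mul_comm]

lemma enorm_sq_eq_lintegral_enorm_sq {α E : Type*} [MeasurableSpace α] {μ : Measure α}
    [NormedAddCommGroup E] (f : Lp E 2 μ) : ‖f‖ₑ ^ 2 = ∫⁻ x, ‖f x‖ₑ ^ 2 ∂μ := by
  rw [Lp.enorm_def]
  simpa using eLpNorm_nnreal_pow_eq_lintegral (f := f) (μ := μ) (p := 2) two_ne_zero

lemma enorm_toeplitz_sub_cutoff_sq_le {u : Lp ℂ ∞ diskMeasure} {v : ℂ → ℂ}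
    (huv : u =ᵐ[diskMeasure] v) (hv : Measurable v) {r : ℝ} {A B : ℝ≥0∞}
    (hA : ∀ w : ℂ, ‖w‖ < 1 →
      ∫⁻ z, ‖toeplitzKernel v w z‖ₑ * schurWeight z ∂diskMeasure ≤ A * schurWeight w)
    (hB : ∀ z : ℂ, ‖z‖ < 1 → r < ‖z‖ →
      ∫⁻ w, ‖toeplitzKernel v w z‖ₑ * schurWeight w ∂diskMeasure ≤ B * schurWeight z)
    (f : bergmanSpace) : ‖toeplitz u (f - cutoff r f)‖ₑ ^ 2 ≤ A * B * ‖f‖ₑ ^ 2 := by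
  let ν := diskMeasure.restrict (closedBall 0 r)ᶜ
  have hν : ∀ᵐ z ∂ν, ‖z‖ < 1 := ae_restrict_of_ae ae_norm_lt_one
  have hνr : ∀ᵐ z ∂ν, r < ‖z‖ := by
    filter_upwards [ae_restrict_mem measurableSet_closedBall.compl] with z hz
    simpa using hz
  have hrepr : (toeplitz u (f - cutoff r f) : Lp ℂ 2 diskMeasure) =ᵐ[diskMeasure] fun w =>
      ∫ z, toeplitzKernel v w z * (f : Lp ℂ 2 diskMeasure) z ∂ν :=
    bergmanSpace.ae_eq_of_forall_apply_eq (toeplitz_sub_cutoff_apply huv r f)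
  calc ‖toeplitz u (f - cutoff r f)‖ₑ ^ 2
      = ∫⁻ w, ‖(toeplitz u (f - cutoff r f) : Lp ℂ 2 diskMeasure) w‖ₑ ^ 2 ∂diskMeasure :=
        enorm_sq_eq_lintegral_enorm_sq _
    _ ≤ ∫⁻ w, (∫⁻ z, ‖toeplitzKernel v w z‖ₑ * ‖(f : Lp ℂ 2 diskMeasure) z‖ₑ ∂ν) ^ 2
          ∂diskMeasure := by
        refine lintegral_mono_ae ?_
        filter_upwards [hrepr] with w hw
        simp only [hw, ← enorm_mul]
        gcongr
        exact enorm_integral_le_lintegral_enorm _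
    _ ≤ A * B * ∫⁻ z, ‖(f : Lp ℂ 2 diskMeasure) z‖ₑ ^ 2 ∂ν :=
        lintegral_lintegral_mul_sq_le_of_schur (measurable_toeplitzKernel hv).enorm
          measurable_schurWeight measurable_schurWeight (Lp.stronglyMeasurable _).enorm
          (hν.mono fun _ hz => schurWeight_ne_zero hz) (.of_forall schurWeight_ne_top)
          (ae_norm_lt_one.mono fun w hw =>
            (lintegral_mono' Measure.restrict_le_self le_rfl).trans (hA w hw))
          (by filter_upwards [hν, hνr] with z hz hzr using hB z hz hzr)
    _ ≤ A * B * ‖f‖ₑ ^ 2 := by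
        gcongr
        exact (lintegral_mono' Measure.restrict_le_self le_rfl).trans_eq
          (enorm_sq_eq_lintegral_enorm_sq _).symm

lemma norm_toeplitz_sub_comp_cutoff_le {u : Lp ℂ ∞ diskMeasure} {v : ℂ → ℂ}
    (huv : u =ᵐ[diskMeasure] v) (hv : Measurable v) {r : ℝ} {A B : ℝ≥0}
    (hA : ∀ w : ℂ, ‖w‖ < 1 →
      ∫⁻ z, ‖toeplitzKernel v w z‖ₑ * schurWeight z ∂diskMeasure ≤ A * schurWeight w)
    (hB : ∀ z : ℂ, ‖z‖ < 1 → r < ‖z‖ →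
      ∫⁻ w, ‖toeplitzKernel v w z‖ₑ * schurWeight w ∂diskMeasure ≤ B * schurWeight z) :
    ‖toeplitz u - toeplitz u ∘L cutoff r‖ ≤ √(A * B) := by
  refine ContinuousLinearMap.opNorm_le_bound _ (Real.sqrt_nonneg _) fun f => ?_
  have hsq : ‖toeplitz u (f - cutoff r f)‖₊ ^ 2 ≤ A * B * ‖f‖₊ ^ 2 := by
    have henorm := enorm_toeplitz_sub_cutoff_sq_le huv hv hA hB f
    rw [enorm_eq_nnnorm, enorm_eq_nnnorm] at henorm
    exact_mod_cast henorm
  rw [sub_apply, ContinuousLinearMap.comp_apply, ← map_sub, ← Real.sqrt_sq (norm_nonneg f),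
    ← Real.sqrt_mul (by positivity)]
  exact Real.le_sqrt_of_sq_le (by exact_mod_cast hsq)

/-! ### Compactness of the cut-off operators -/

lemma continuous_of_continuous_inner {𝕜 E X : Type*} [RCLike 𝕜] [NormedAddCommGroup E]
    [InnerProductSpace 𝕜 E] [TopologicalSpace X] {k : X → E}
    (h : Continuous fun p : X × X => inner 𝕜 (k p.1) (k p.2)) : Continuous k := by
  refine continuous_iff_continuousAt.2 fun x => tendsto_iff_norm_sub_tendsto_zero.2 ?_
  have hre : Continuous fun p : X × X => RCLike.re (inner 𝕜 (k p.1) (k p.2)) :=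
    RCLike.continuous_re.comp h
  have hsq : Tendsto (fun y => ‖k y - k x‖ ^ 2) (𝓝 x) (𝓝 (‖k x - k x‖ ^ 2)) := by
    simp only [norm_sub_sq (𝕜 := 𝕜), ← inner_self_eq_norm_sq (𝕜 := 𝕜)]
    exact (((hre.comp (by fun_prop : Continuous fun y => (y, y))).sub
      ((hre.comp (by fun_prop : Continuous fun y => (y, x))).const_mul 2)).add_const _).tendsto x
  simpa using hsq.sqrt

lemma continuous_bergmanKernel : Continuous bergmanKernel := by
  refine continuous_of_continuous_inner (𝕜 := ℂ) ?_
  simp only [inner_bergmanKernel, bergmanKernel_apply, kernelFun]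
  exact Continuous.inv₀ (by fun_prop) fun p =>
    pow_ne_zero _ (one_sub_conj_mul_ne_zero p.2.norm_lt_one p.1.norm_lt_one)

lemma isCompact_setOf_norm_le {r : ℝ} (hr : r < 1) : IsCompact {z : 𝔻 | ‖(z : ℂ)‖ ≤ r} := by
  rw [Complex.UnitDisc.isEmbedding_coe.isCompact_iff]
  convert isCompact_closedBall (0 : ℂ) r using 1
  ext w
  simp only [mem_image, mem_ofPred_eq, mem_closedBall_zero_iff]
  exact ⟨fun ⟨_, hz, h⟩ => h ▸ hz, fun hw => ⟨Complex.UnitDisc.mk w (hw.trans_lt hr), hw, rfl⟩⟩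

lemma norm_cutoff_le {r δ : ℝ} (hδ : 0 ≤ δ) {g : bergmanSpace}
    (hg : ∀ z : 𝔻, ‖(z : ℂ)‖ ≤ r → ‖g z‖ ≤ δ) : ‖cutoff r g‖ ≤ δ := by
  refine (norm_toeplitz_apply_le _ g).trans
    ((Lp.norm_le_of_ae_bound hδ ?_).trans_eq (by simp [measureUnivNNReal]))
  filter_upwards [mulOp_ae_eq (closedBallIndicator r) g, bergmanSpace.coe_ae_eq_rep g,
    closedBallIndicator_ae_eq r, ae_norm_lt_one] with z hmul hrep hχ hz
  lift z to 𝔻 using hz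
  rw [hmul, hrep, hχ, ← bergmanSpace.apply_eq (bergmanSpace.differentiableOn_rep g)
    (bergmanSpace.coe_ae_eq_rep g)]
  by_cases hzr : (z : ℂ) ∈ closedBall 0 r
  · simpa [hzr] using hg z (mem_closedBall_zero_iff.1 hzr)
  · simpa [hzr] using hδ

lemma isCompactOperator_cutoff {r : ℝ} (hr : r < 1) : IsCompactOperator (cutoff r) := by
  refine isCompactOperator_of_totallyBounded (𝕜 := ℂ)
    ((isCompact_setOf_norm_le hr).image continuous_bergmanKernel).totallyBounded
    fun f δ hδ hf => norm_cutoff_le hδ fun z hz => ?_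
  rw [← inner_bergmanKernel]
  exact hf _ (mem_image_of_mem _ hz)

/-! ### Compactness and the boundary values of the Berezin transform -/

lemma inner_normalizedKernel (z : 𝔻) (f : bergmanSpace) :
    inner ℂ (normalizedKernel z) f = (1 - (‖(z : ℂ)‖ : ℂ) ^ 2) * f z := by
  rw [normalizedKernel_eq, inner_smul_left (𝕜 := ℂ) (E := bergmanSpace), inner_bergmanKernel,
    conj_one_sub_norm_sq]

lemma tendsto_inner_normalizedKernel_bergmanKernel (w : 𝔻) :
    Tendsto (fun z => inner ℂ (normalizedKernel z) (bergmanKernel w)) toBoundary (𝓝 0) := by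
  have hfactor : Tendsto (fun z : 𝔻 => 1 - (‖(z : ℂ)‖ : ℂ) ^ 2) toBoundary (𝓝 0) := by
    simpa using (((Complex.continuous_ofReal.tendsto 1).comp tendsto_norm_toBoundary).pow
      2).const_sub 1
  simp only [inner_normalizedKernel, bergmanKernel_apply]
  exact hfactor.zero_mul_isBoundedUnder_le (isBoundedUnder_of ⟨_, fun z =>
    norm_kernelFun_le w.norm_lt_one z.norm_lt_one.le⟩)

lemma tendsto_inner_normalizedKernel (f : bergmanSpace) :
    Tendsto (fun z => inner ℂ (normalizedKernel z) f) toBoundary (𝓝 0) := by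
  let N : Submodule ℂ bergmanSpace :=
    vanishingSubmodule (fun z => innerSL ℂ (normalizedKernel z)) toBoundary
  have hN : IsClosed (N : Set bergmanSpace) := isClosed_vanishingSubmodule (C := 1)
    (fun z => by rw [innerSL_apply_norm, norm_normalizedKernel]) _
  have hspan : Submodule.span ℂ {RKHS.kerFun bergmanSpace z c | (z) (c)} ≤ N := by
    rw [Submodule.span_le]
    rintro - ⟨z, c, rfl⟩
    rw [← mul_one c, ← smul_eq_mul, map_smul]
    exact N.smul_mem c (tendsto_inner_normalizedKernel_bergmanKernel z)
  exact Submodule.topologicalClosure_minimal _ hspan hN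
    (RKHS.kerFun_dense bergmanSpace ▸ Submodule.mem_top)

lemma tendsto_berezin_of_isCompactOperator {S : bergmanSpace →L[ℂ] bergmanSpace}
    (hS : IsCompactOperator S) : Tendsto (berezin S) toBoundary (𝓝 0) :=
  tendsto_inner_apply_of_isCompactOperator hS (fun z => (norm_normalizedKernel z).le)
    tendsto_inner_normalizedKernel

lemma exists_forall_lt_norm_of_eventually {p : 𝔻 → Prop} (h : ∀ᶠ z in toBoundary, p z) :
    ∃ r < 1, ∀ z : 𝔻, r < ‖(z : ℂ)‖ → p z := by
  obtain ⟨r, hr, hp⟩ := exists_Ioc_subset_of_mem_nhds (eventually_comap.1 h) ⟨0, one_pos⟩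
  exact ⟨r, hr, fun z hz => hp ⟨hz, z.norm_lt_one.le⟩ z rfl⟩

lemma exists_lintegral_toeplitzKernel_left_le {v : ℂ → ℂ} (hv : Measurable v) {M : ℝ}
    (hM : ∀ w, ‖v w‖ ≤ M)
    (hB : Tendsto (fun z : 𝔻 => berezinTransform v z) toBoundary (𝓝 0)) {B : ℝ≥0} (hB₀ : 0 < B) :
    ∃ r < 1, ∀ z : ℂ, ‖z‖ < 1 → r < ‖z‖ →
      ∫⁻ w, ‖toeplitzKernel v w z‖ₑ * schurWeight w ∂diskMeasure ≤ B * schurWeight z := by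
  obtain ⟨C, hC⟩ := exists_lintegral_toeplitzKernel_mul_schurWeight_le
  have hlim : Tendsto (fun z : 𝔻 =>
      C * eLpNorm (fun a => toeplitzKernel (v ∘ moebius z) a 0) 6 diskMeasure)
      toBoundary (𝓝 0) := by
    simpa using ENNReal.Tendsto.const_mul (a := C)
      (tendsto_eLpNorm_toeplitzKernel_comp_moebius hv hM hB) (.inr ENNReal.coe_ne_top)
  obtain ⟨r, hr, hrB⟩ := exists_forall_lt_norm_of_eventually
    (hlim.eventually_le_const (ENNReal.coe_pos.2 hB₀))
  refine ⟨r, hr, fun z hz hrz => (hC v hv z hz).trans ?_⟩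
  gcongr
  exact hrB (.mk z hz) hrz

lemma isCompactOperator_toeplitz_of_tendsto_berezinSymbol {u : Lp ℂ ∞ diskMeasure}
    (hu : Tendsto (berezinSymbol u) toBoundary (𝓝 0)) : IsCompactOperator (toeplitz u) := by
  obtain ⟨v, hv, hM, huv⟩ := exists_stronglyMeasurable_norm_le_ae_eq u
  have hB : Tendsto (fun z : 𝔻 => berezinTransform v z) toBoundary (𝓝 0) :=
    hu.congr (berezinSymbol_eq huv)
  obtain ⟨A, hA⟩ := exists_lintegral_toeplitzKernel_right_le hv.measurable hM
  refine isCompactOperator_of_forall_norm_sub_le fun ε hε => ?_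
  lift ε to ℝ≥0 using hε.le
  have hB₀ : 0 < ε ^ 2 / (A + 1) := div_pos (pow_pos (NNReal.coe_pos.1 hε) 2) (by positivity)
  obtain ⟨r, hr, hrB⟩ := exists_lintegral_toeplitzKernel_left_le hv.measurable hM hB hB₀
  refine ⟨toeplitz u ∘L cutoff r, (isCompactOperator_cutoff hr).clm_comp (toeplitz u),
    (norm_toeplitz_sub_comp_cutoff_le huv hv.measurable hA hrB).trans ?_⟩
  rw [Real.sqrt_le_left hε.le]
  norm_cast
  calc A * (ε ^ 2 / (A + 1)) ≤ (A + 1) * (ε ^ 2 / (A + 1)) := by gcongr; exact le_self_add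
    _ = ε ^ 2 := by field_simp

end

theorem mainTheorem2 (u : Lp ℂ ∞ diskMeasure) :
    IsCompactOperator (toeplitz u) ↔ Tendsto (berezinSymbol u) toBoundary (𝓝 0) :=
  ⟨tendsto_berezin_of_isCompactOperator, isCompactOperator_toeplitz_of_tendsto_berezinSymbol⟩
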